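/- Write points of $\mathbb R^4$ as $(x_1,y_1,x_2,y_2)$ with $z_j=x_j+iy_j$, and let $\Gamma\subset O(4)$ be the group generated by $\rho:(z_1,z_2)\mapsto(z_1,e^{2\pi i/3}z_2)$ and $\kappa:(z_1,z_2)\mapsto(\bar z_1,\bar z_2)$. For a subgroup $\Sigma$ let $\mathrm{Fix}(\Sigma)$ be the subspace of points fixed by $\Sigma$. For a smooth $\Gamma$-equivariant vector field $f$, a *robust heteroclinic cycle* consists of equilibria $\xi_1,\dots,\xi_M$ with isotropy groups $\Delta_j$, isotropy subgroups $\Sigma_j\subset\Delta_j$ of $\Gamma$ and non-constant trajectories $\kappa_j$ of $\dot x=f(x)$ (indices mod $M$) such that: $L_j=\mathrm{Fix}(\Delta_j)$ is a line and $P_j=\mathrm{Fix}(\Sigma_j)$ is a plane; $L_j=P_{j-1}\cap P_j$; $\xi_j$ is a hyperbolic sink in $P_{j-1}$ and a hyperbolic saddle in $P_j$; and $\kappa_j$ lies in $P_j$ and tends to $\xi_j$ as $t\to-\infty$ and to $\xi_{j+1}$ as $t\to+\infty$. It is *pseudo-simple* if each connected component of $L_j\setminus\{0\}$ meets the cycle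 (the equilibria and the trajectories $\kappa_j$) in at most one point, and for some $j$ the isotypic decomposition of the representation of $\Delta_j$ on $\mathbb R^4$ has a component that is not one-dimensional. $\Gamma$ *admits pseudo-simple cycles* if there is a non-empty open set of smooth $\Gamma$-equivariant vector fields on $\mathbb R^4$, each of which has a pseudo-simple heteroclinic cycle. Here "open" refers to the topology of uniform convergence of $f$ and $df$ on compact sets (so the set is open in all finer $C^r$ topologies, $1\le r\le\infty$, too). **Proposition.** $\Gamma$ is contained in $SO(4)$, is isomorphic to the dihedral group $\mathbb D_3$ of order $6$, and admits pseudo-simple cycles. More precisely, there is a non-empty open set $U$ of smooth $\Gamma$-equivariant vector fields such that every $f\in U$ has a pseudo-simple heteroclinic cycle $\xi_1\to\xi_2\to\xi_1$ with $\Sigma_1=\langle\rho\rangle$ and $\Sigma_2=\langle\kappa\rangle$ (so that the connection $\xi_1\to\xi_2$ lies in the plane $P_1=\mathrm{Fix}(\rho)$ and the connection $\xi_2\to\xi_1$ lies in the plane $P_2=\mathrm{Fix}(\kappa)$), and such that $df(\xi_1)$ has a negative and $df(\xi_2)$ a positive double eigenvalue, each with eigenspace (and generalized eigenspace) equal to the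 $z_2$-plane $\{(0,0,x_2,y_2)\}$. -/

import Mathlib

open Filter Topology
open scoped ContDiff

namespace PseudoSimple

/-- The Euclidean space `ℝ⁴`, with coordinates `(x₁, y₁, x₂, y₂)`. -/
abbrev E4 : Type := EuclideanSpace ℝ (Fin 4)

/-- The orthogonal group `O(4)`, as the group of linear isometries of `ℝ⁴`. -/
abbrev O4 : Type := E4 ≃ₗᵢ[ℝ] E4

/-! ### Isotropy subgroups and fixed-point subspaces -/

/-- The isotropy subgroup of the point `x` in `Γ`. -/
def isotropy (Γ : Subgroup O4) (x : E4) : Subgroup O4 where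
  carrier := {γ | γ ∈ Γ ∧ γ x = x}
  one_mem' := ⟨Γ.one_mem, rfl⟩
  mul_mem' := by
    rintro a b ⟨ha, hax⟩ ⟨hb, hbx⟩
    refine ⟨Γ.mul_mem ha hb, ?_⟩
    rw [LinearIsometryEquiv.coe_mul, Function.comp_apply, hbx, hax]
  inv_mem' := by
    rintro a ⟨ha, hax⟩
    refine ⟨Γ.inv_mem ha, ?_⟩
    change a.symm x = x
    rw [LinearIsometryEquiv.symm_apply_eq, hax]

/-- `S` is an isotropy subgroup of `Γ`. -/
def IsIsotropySubgroup (Γ S : Subgroup O4) : Prop :=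
  ∃ x : E4, S = isotropy Γ x

/-- The fixed-point subspace `Fix(S)`. -/
def fixedSpace (S : Subgroup O4) : Submodule ℝ E4 where
  carrier := {x | ∀ γ ∈ S, γ x = x}
  add_mem' := by
    intro a b ha hb γ hγ
    rw [map_add, ha γ hγ, hb γ hγ]
  zero_mem' := by
    intro γ _
    exact map_zero γ
  smul_mem' := by
    intro c x hx γ hγ
    rw [map_smul, hx γ hγ]

/-! ### Smooth equivariant vector fields and their topology -/

/-- The set of smooth `Γ`-equivariant vector fields on `ℝ⁴`. -/
def EquivariantField (Γ : Subgroup O4) : Type :=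
  {f : E4 → E4 // ContDiff ℝ ∞ f ∧ ∀ γ ∈ Γ, ∀ x, f (γ x) = γ (f x)}

instance (Γ : Subgroup O4) : CoeFun (EquivariantField Γ) (fun _ => E4 → E4) :=
  ⟨Subtype.val⟩

/-- The pair `(f, df)`, as a pair of continuous maps. -/
noncomputable def EquivariantField.oneJet {Γ : Subgroup O4} (f : EquivariantField Γ) :
    C(E4, E4) × C(E4, E4 →L[ℝ] E4) :=
  (⟨f, f.2.1.continuous⟩, ⟨fderiv ℝ f, f.2.1.continuous_fderiv (by simp)⟩)

/-- The topology of uniform convergence on compact sets of `f` and of its first derivative.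
It is coarser than the `C^r` topologies for all `1 ≤ r ≤ ∞`, weak (compact-open) or strong
(Whitney), so that a set which is open here is open for each of those as well. -/
noncomputable instance (Γ : Subgroup O4) : TopologicalSpace (EquivariantField Γ) :=
  TopologicalSpace.induced EquivariantField.oneJet inferInstance

/-! ### Sinks, saddles and connections -/

/-- `ξ` is a (hyperbolic) sink in the invariant plane `P`: the restriction of `df(ξ)` to `P` has
only eigenvalues (in `ℂ`) with negative real part. -/
def IsSinkIn (f : E4 → E4) (ξ : E4) (P : Submodule ℝ E4) : Prop :=
  ∃ h : ∀ v ∈ P, (fderiv ℝ f ξ : E4 →ₗ[ℝ] E4) v ∈ P,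
    ∀ z ∈ (LinearMap.charpoly ((fderiv ℝ f ξ : E4 →ₗ[ℝ] E4).restrict h)).aroots ℂ, z.re < 0

/-- `ξ` is a (hyperbolic) saddle in the invariant plane `P`: the restriction of `df(ξ)` to `P`
has no eigenvalue (in `ℂ`) on the imaginary axis, one with negative and one with positive
real part. -/
def IsSaddleIn (f : E4 → E4) (ξ : E4) (P : Submodule ℝ E4) : Prop :=
  ∃ h : ∀ v ∈ P, (fderiv ℝ f ξ : E4 →ₗ[ℝ] E4) v ∈ P,
    (∀ z ∈ (LinearMap.charpoly ((fderiv ℝ f ξ : E4 →ₗ[ℝ] E4).restrict h)).aroots ℂ, z.re ≠ 0) ∧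
    (∃ z ∈ (LinearMap.charpoly ((fderiv ℝ f ξ : E4 →ₗ[ℝ] E4).restrict h)).aroots ℂ, z.re < 0) ∧
    (∃ z ∈ (LinearMap.charpoly ((fderiv ℝ f ξ : E4 →ₗ[ℝ] E4).restrict h)).aroots ℂ, 0 < z.re)

/-- `x` is a non-constant trajectory of `ẋ = f(x)` in `P` that connects the equilibrium `a`
to the equilibrium `b`. -/
structure IsConnection (f : E4 → E4) (P : Submodule ℝ E4) (a b : E4) (x : ℝ → E4) : Prop where
  solution : ∀ t, HasDerivAt x (f (x t)) t
  mem_plane : ∀ t, x t ∈ P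
  nonconstant : ∃ t, x t ≠ a
  tendsto_atBot : Tendsto x atBot (𝓝 a)
  tendsto_atTop : Tendsto x atTop (𝓝 b)

/-! ### Robust heteroclinic cycles -/

/-- The equilibria `ξ j` and the connecting trajectories `κ j : ξ j → ξ (j+1)` (indices mod `M`)
form a robust heteroclinic cycle of the `Γ`-equivariant vector field `f`, with
`Δ j = isotropy Γ (ξ j)`, axes `L j = fixedSpace (Δ j)` and planes `P j = fixedSpace (S j)`. -/
structure IsRobustHeteroclinicCycle (Γ : Subgroup O4) (f : E4 → E4) {M : ℕ} [NeZero M]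
    (ξ : Fin M → E4) (S : Fin M → Subgroup O4) (κ : Fin M → ℝ → E4) : Prop where
  equilibrium : ∀ j, f (ξ j) = 0
  dim_axis : ∀ j, Module.finrank ℝ (fixedSpace (isotropy Γ (ξ j))) = 1
  isotropy_plane : ∀ j, IsIsotropySubgroup Γ (S j)
  plane_le : ∀ j, S j ≤ isotropy Γ (ξ j)
  dim_plane : ∀ j, Module.finrank ℝ (fixedSpace (S j)) = 2
  axis_eq : ∀ j, fixedSpace (isotropy Γ (ξ (j + 1))) = fixedSpace (S j) ⊓ fixedSpace (S (j + 1))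
  saddle : ∀ j, IsSaddleIn f (ξ j) (fixedSpace (S j))
  sink : ∀ j, IsSinkIn f (ξ (j + 1)) (fixedSpace (S j))
  connection : ∀ j, IsConnection f (fixedSpace (S j)) (ξ j) (ξ (j + 1)) (κ j)

/-- The subset of `ℝ⁴` formed by the equilibria and the connecting trajectories. -/
def cycleSet {M : ℕ} (ξ : Fin M → E4) (κ : Fin M → ℝ → E4) : Set E4 :=
  Set.range ξ ∪ ⋃ j, Set.range (κ j)

/-- The representation on `ℝ⁴` of a subgroup of `O(4)`. -/
def naturalRep (D : Subgroup O4) : Representation ℝ D E4 where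
  toFun γ := ((γ : O4).toLinearEquiv : E4 →ₗ[ℝ] E4)
  map_one' := rfl
  map_mul' _ _ := rfl

/-- All components of the isotypic decomposition of the representation of `D` on `ℝ⁴` are
one-dimensional. -/
def HasOneDimIsotypicComponents (D : Subgroup O4) : Prop :=
  ∀ c ∈ isotypicComponents (MonoidAlgebra ℝ D) (naturalRep D).asModule,
    Module.finrank ℝ (c.restrictScalars ℝ) = 1

/-- A robust heteroclinic cycle is pseudo-simple if every connected component of `L j ∖ {0}` meets
the cycle in at most one point, and if the isotypic decomposition of the representation of
`Δ j` on `ℝ⁴` has, for some `j`, a component which is not one-dimensional. -/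
structure IsPseudoSimpleCycle (Γ : Subgroup O4) (f : E4 → E4) {M : ℕ} [NeZero M]
    (ξ : Fin M → E4) (S : Fin M → Subgroup O4) (κ : Fin M → ℝ → E4) : Prop
    extends IsRobustHeteroclinicCycle Γ f ξ S κ where
  component_meets_once : ∀ j, ∀ x ∈ (fixedSpace (isotropy Γ (ξ j)) : Set E4) \ {0},
    (connectedComponentIn ((fixedSpace (isotropy Γ (ξ j)) : Set E4) \ {0}) x ∩
      cycleSet ξ κ).Subsingleton
  not_simple : ¬ ∀ j, HasOneDimIsotypicComponents (isotropy Γ (ξ j))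

/-- `Γ` admits pseudo-simple heteroclinic cycles: a non-empty open set of smooth `Γ`-equivariant
vector fields consists of vector fields with a pseudo-simple heteroclinic cycle. -/
def AdmitsPseudoSimpleCycles (Γ : Subgroup O4) : Prop :=
  ∃ U : Set (EquivariantField Γ), IsOpen U ∧ U.Nonempty ∧ ∀ f ∈ U,
    ∃ (M : ℕ) (_ : NeZero M) (ξ : Fin M → E4) (S : Fin M → Subgroup O4) (κ : Fin M → ℝ → E4),
      IsPseudoSimpleCycle Γ f ξ S κ

/-! ### The group generated by `ρ` and `κ` -/

/-- The complex coordinate `z₁ = x₁ + i y₁`. -/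
def z1 (v : E4) : ℂ := ⟨v 0, v 1⟩

/-- The complex coordinate `z₂ = x₂ + i y₂`. -/
def z2 (v : E4) : ℂ := ⟨v 2, v 3⟩

/-- The point of `ℝ⁴` with complex coordinates `(z, w)`. -/
noncomputable def ofComplex (z w : ℂ) : E4 := !₂[z.re, z.im, w.re, w.im]

@[simp] lemma z1_ofComplex (z w : ℂ) : z1 (ofComplex z w) = z := by
  simp [z1, ofComplex]

@[simp] lemma z2_ofComplex (z w : ℂ) : z2 (ofComplex z w) = w := by
  simp [z2, ofComplex]

@[simp] lemma ofComplex_z (v : E4) : ofComplex (z1 v) (z2 v) = v := by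
  ext i
  fin_cases i <;> simp [z1, z2, ofComplex]

lemma z1_add (v w : E4) : z1 (v + w) = z1 v + z1 w := rfl

lemma z2_add (v w : E4) : z2 (v + w) = z2 v + z2 w := rfl

lemma z1_smul (c : ℝ) (v : E4) : z1 (c • v) = c • z1 v := by
  apply Complex.ext <;> simp [z1]

lemma z2_smul (c : ℝ) (v : E4) : z2 (c • v) = c • z2 v := by
  apply Complex.ext <;> simp [z2]

lemma ofComplex_add (a b c d : ℂ) :
    ofComplex (a + b) (c + d) = ofComplex a c + ofComplex b d := by
  ext i
  fin_cases i <;> simp [ofComplex]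

lemma ofComplex_smul (c : ℝ) (a b : ℂ) : ofComplex (c • a) (c • b) = c • ofComplex a b := by
  ext i
  fin_cases i <;> simp [ofComplex]

lemma norm_sq_eq (v : E4) : ‖v‖ ^ 2 = ‖z1 v‖ ^ 2 + ‖z2 v‖ ^ 2 := by
  rw [EuclideanSpace.norm_sq_eq, Fin.sum_univ_four, Complex.sq_norm, Complex.sq_norm,
    Complex.normSq_apply, Complex.normSq_apply]
  simp only [z1, z2, Real.norm_eq_abs, sq_abs]
  ring

/-- The real-linear isometry `(z₁, z₂) ↦ (A z₁, B z₂)`. -/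
noncomputable def prodIsometry (A B : ℂ ≃ₗᵢ[ℝ] ℂ) : O4 where
  toFun v := ofComplex (A (z1 v)) (B (z2 v))
  invFun v := ofComplex (A.symm (z1 v)) (B.symm (z2 v))
  map_add' v w := by rw [z1_add, z2_add, map_add, map_add, ofComplex_add]
  map_smul' c v := by
    rw [z1_smul, z2_smul, map_smul, map_smul, ofComplex_smul, RingHom.id_apply]
  left_inv v := by simp
  right_inv v := by simp
  norm_map' v := by
    rw [← sq_eq_sq₀ (norm_nonneg _) (norm_nonneg _), norm_sq_eq, norm_sq_eq v]
    simp

/-- `ρ : (z₁, z₂) ↦ (z₁, e^{2πi/3} z₂)`. -/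
noncomputable def rho : O4 :=
  prodIsometry (LinearIsometryEquiv.refl ℝ ℂ) (rotation (Circle.exp (2 * Real.pi / 3)))

/-- `κ : (z₁, z₂) ↦ (z̄₁, z̄₂)`. -/
noncomputable def kappa : O4 := prodIsometry Complex.conjLIE Complex.conjLIE

/-- The group `Γ` generated by `ρ` and `κ`. -/
noncomputable def Gam : Subgroup O4 := Subgroup.closure {rho, kappa}

lemma rho_apply (v : E4) :
    rho v = ofComplex (z1 v) (Complex.exp (2 * Real.pi * Complex.I / 3) * z2 v) := by
  change ofComplex (z1 v) ((Circle.exp (2 * Real.pi / 3) : ℂ) * z2 v) = _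
  rw [Circle.coe_exp]
  push_cast
  rw [show (2 * (Real.pi : ℂ) / 3) * Complex.I = 2 * Real.pi * Complex.I / 3 by ring]

lemma kappa_apply (v : E4) :
    kappa v = ofComplex ((starRingEnd ℂ) (z1 v)) ((starRingEnd ℂ) (z2 v)) := rfl

/-- The `z₂`-plane `{(0, 0, x₂, y₂)}`. -/
def z2Plane : Submodule ℝ E4 where
  carrier := {v | v 0 = 0 ∧ v 1 = 0}
  add_mem' := by
    rintro a b ⟨ha, ha'⟩ ⟨hb, hb'⟩
    exact ⟨by simp [ha, hb], by simp [ha', hb']⟩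
  zero_mem' := ⟨rfl, rfl⟩
  smul_mem' := by
    rintro c a ⟨ha, ha'⟩
    exact ⟨by simp [ha], by simp [ha']⟩

/-- `l` is a double eigenvalue of `df(ξ)` (geometrically and algebraically), and its eigenspace
is the `z₂`-plane. -/
def IsDoubleEigenvalueOnZ2 (f : E4 → E4) (ξ : E4) (l : ℝ) : Prop :=
  Module.End.eigenspace (fderiv ℝ f ξ : E4 →ₗ[ℝ] E4) l = z2Plane ∧
    Module.End.maxGenEigenspace (fderiv ℝ f ξ : E4 →ₗ[ℝ] E4) l = z2Plane

end PseudoSimple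

/-!
Points `ξ` of the `x₁`-axis `Fix Γ` are fixed by all of `Γ`, so that `df(ξ)` commutes with `ρ` and
`κ`; it is therefore diagonal, and scalar on the `z₂`-plane (`apply_eq_of_commute`). All spectral
conditions on the cycle become inequalities between three real numbers at each of two equilibria on
the axis, one near `-1` and one near `1`. They hold for the explicit field `modelMap`, and by
`exists_diagonal_fderiv` for every equivariant field that is `C¹`-close to it.

The connections need no invariant manifold theory. Restricted to either of the invariant planes
`Fix ρ` and `Fix κ`, the latter reflected by `x₁ ↦ -x₁`, the model field is the planar field
`(x (1 - r²) + y², y (1 - r²) - x y)`: it points into the annulus `3/4 ≤ r ≤ 5/4`, and turns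
clockwise in its upper half, from the negative to the positive half-axis. Fields near the model share these
properties (`IsTurningField`, `isTurningField_planeField`); the axis `y = 0` is invariant by
equivariance, so that the angular velocity is controlled up to the axis by the closeness of the
derivatives. For such a planar field, the orbits through the segment `x = 0` that leave the annulus
backwards in time form two disjoint nonempty open sets, according to the circle through which they
leave. By connectedness some orbit stays in the annulus for all times
(`IsTurningField.exists_orbit_in_annulus`). Along it `x / y` has derivative bounded below by a
positive constant, hence tends to `±∞` and `y` tends to `0`; the contraction along the axis then
forces convergence to the equilibria (`IsTurningField.exists_connection`).

The cycle is not simple because the `z₂`-plane is an irreducible representation of `Γ` of dimension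
two, and the cycle meets each half-axis only once because the connections have `y > 0`.
-/

namespace PseudoSimple

/-! ### Global solutions of Lipschitz ordinary differential equations -/

/-- A bounded Lipschitz vector field is complete: the Picard-Lindelöf solutions on the intervals
`[-(n + 1), n + 1]` agree where they overlap and are glued together. -/
lemma exists_global_solution {E : Type*} [NormedAddCommGroup E] [NormedSpace ℝ E]
    [CompleteSpace E] {G : E → E} {K C : NNReal} (hK : LipschitzWith K G) (hC : ∀ x, ‖G x‖ ≤ C)
    (x₀ : E) : ∃ α : ℝ → E, α 0 = x₀ ∧ ∀ t, HasDerivAt α (G (α t)) t := by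
  have hloc : ∀ n : ℕ, ∃ α : ℝ → E, α 0 = x₀ ∧
      ∀ t ∈ Set.Ioo (-(n + 1 : ℝ)) (n + 1), HasDerivAt α (G (α t)) t := by
    intro n
    have hn : (0 : ℝ) ≤ n := n.cast_nonneg
    have h0 : (0 : ℝ) ∈ Set.Icc (-(n + 1 : ℝ)) (n + 1) := ⟨by linarith, by linarith⟩
    have hpl : IsPicardLindelof (fun _ ↦ G) (⟨0, h0⟩ : Set.Icc (-(n + 1 : ℝ)) (n + 1)) x₀
        (C * (n + 1)) 0 C K := by
      refine .of_time_independent (fun x _ ↦ hC x) hK.lipschitzOnWith ?_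
      simp
    obtain ⟨α, hα, hd⟩ := hpl.exists_eq_forall_mem_Icc_hasDerivWithinAt₀
    exact ⟨α, hα, fun t ht ↦
      (hd t (Set.Ioo_subset_Icc_self ht)).hasDerivAt (Icc_mem_nhds ht.1 ht.2)⟩
  choose A hA0 hA using hloc
  have hagree : ∀ {n m : ℕ}, n ≤ m → Set.EqOn (A n) (A m) (Set.Ioo (-(n + 1 : ℝ)) (n + 1)) := by
    intro n m hnm
    have hnm' : (n : ℝ) ≤ m := by exact_mod_cast hnm
    have hn : (0 : ℝ) ≤ n := n.cast_nonneg
    refine ODE_solution_unique_of_mem_Ioo (v := fun _ ↦ G) (s := fun _ ↦ Set.univ) (K := K)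
      (t₀ := 0) (fun _ _ ↦ hK.lipschitzOnWith) ⟨by linarith, by linarith⟩
      (fun t ht ↦ ⟨hA n t ht, trivial⟩) (fun t ht ↦ ⟨hA m t ⟨?_, ?_⟩, trivial⟩)
      (by rw [hA0, hA0])
    · linarith [ht.1]
    · linarith [ht.2]
  refine ⟨fun t ↦ A ⌊|t|⌋₊ t, by simp [hA0], fun t ↦ ?_⟩
  have ht : t ∈ Set.Ioo (-(⌊|t|⌋₊ + 1 : ℝ)) (⌊|t|⌋₊ + 1) :=
    abs_lt.1 (Nat.lt_floor_add_one |t|)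
  refine (hA _ t ht).congr_of_eventuallyEq ?_
  filter_upwards [Ioo_mem_nhds ht.1 ht.2] with s hs
  have hs' : |s| < ((⌊|t|⌋₊ + 1 : ℕ) : ℝ) := by
    push_cast
    exact abs_lt.2 hs
  exact hagree (Nat.lt_succ_iff.1 ((Nat.floor_lt (abs_nonneg s)).2 hs'))
    (abs_lt.1 (Nat.lt_floor_add_one |s|))

/-- Grönwall's bound for the distance of two solutions, backwards in time. -/
lemma dist_le_of_solutions_of_nonpos {E : Type*} [NormedAddCommGroup E] [NormedSpace ℝ E]
    {G : E → E} {K : NNReal} (hK : LipschitzWith K G) {α β : ℝ → E}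
    (hα : ∀ t, HasDerivAt α (G (α t)) t) (hβ : ∀ t, HasDerivAt β (G (β t)) t) {t : ℝ}
    (ht : t ≤ 0) : dist (α t) (β t) ≤ dist (α 0) (β 0) * Real.exp (K * -t) := by
  have hrev : ∀ {γ : ℝ → E}, (∀ t, HasDerivAt γ (G (γ t)) t) →
      ∀ s, HasDerivAt (fun s ↦ γ (-s)) (-G (γ (-s))) s := by
    intro γ hγ s
    simpa [Function.comp_def] using (hγ (-s)).scomp s (hasDerivAt_neg s)
  have := dist_le_of_trajectories_ODE (v := fun _ x ↦ -G x) (K := K) (a := 0) (b := -t)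
    (fun _ ↦ hK.neg) (fun s _ ↦ (hrev hα s).continuousAt.continuousWithinAt)
    (fun s _ ↦ (hrev hα s).hasDerivWithinAt)
    (fun s _ ↦ (hrev hβ s).continuousAt.continuousWithinAt)
    (fun s _ ↦ (hrev hβ s).hasDerivWithinAt) le_rfl (-t) ⟨by linarith, le_rfl⟩
  simpa using this

/-! ### Differential inequalities -/

/-- A sublevel set at whose boundary `φ` decreases cannot be left forwards in time. -/
lemma le_of_deriv_neg_of_eq {φ φ' : ℝ → ℝ} {c t₀ t : ℝ} (hφ : ∀ t, HasDerivAt φ (φ' t) t)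
    (h : ∀ t, φ t = c → φ' t < 0) (h₀ : φ t₀ ≤ c) (ht : t₀ ≤ t) : φ t ≤ c :=
  image_le_of_deriv_right_lt_deriv_boundary' (B := fun _ ↦ c) (B' := fun _ ↦ 0)
    (fun s _ ↦ (hφ s).continuousAt.continuousWithinAt) (fun s _ ↦ (hφ s).hasDerivWithinAt) h₀
    continuousOn_const (fun s _ ↦ (hasDerivAt_const s c).hasDerivWithinAt) (fun s _ ↦ h s)
    ⟨ht, le_rfl⟩

lemma le_exp_of_deriv_le {D D' : ℝ → ℝ} {k e t₀ t : ℝ} (hk : 0 < k)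
    (hD : ∀ t, HasDerivAt D (D' t) t) (h : ∀ s ∈ Set.Icc t₀ t, D' s ≤ -k * D s + e)
    (ht : t₀ ≤ t) : D t ≤ (D t₀ - e / k) * Real.exp (-k * (t - t₀)) + e / k := by
  have hd : ∀ s, HasDerivAt (fun s ↦ (D s - e / k) * Real.exp (k * (s - t₀)))
      (D' s * Real.exp (k * (s - t₀)) + (D s - e / k) * (Real.exp (k * (s - t₀)) * k)) s := by
    intro s
    have h1 : HasDerivAt (fun s ↦ k * (s - t₀)) k s := by
      simpa using ((hasDerivAt_id s).sub_const t₀).const_mul k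
    exact ((hD s).sub_const _).mul h1.exp
  have hanti : AntitoneOn (fun s ↦ (D s - e / k) * Real.exp (k * (s - t₀))) (Set.Icc t₀ t) := by
    refine antitoneOn_of_hasDerivWithinAt_nonpos (convex_Icc _ _)
      (fun s _ ↦ (hd s).continuousAt.continuousWithinAt)
      (fun s _ ↦ (hd s).hasDerivWithinAt) (fun s hs ↦ ?_)
    have h2 := h s (interior_subset hs)
    have h3 : D' s * Real.exp (k * (s - t₀)) + (D s - e / k) * (Real.exp (k * (s - t₀)) * k)
        = (D' s + k * D s - e) * Real.exp (k * (s - t₀)) := by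
      field_simp
      ring
    rw [h3]
    exact mul_nonpos_of_nonpos_of_nonneg (by linarith) (Real.exp_pos _).le
  have h4 := hanti ⟨le_rfl, ht⟩ ⟨ht, le_rfl⟩ ht
  simp only [sub_self, mul_zero, Real.exp_zero, mul_one] at h4
  have h5 : Real.exp (k * (t - t₀)) * Real.exp (-k * (t - t₀)) = 1 := by
    rw [← Real.exp_add]
    simp
  have h6 := mul_le_mul_of_nonneg_right h4 (Real.exp_pos (-k * (t - t₀))).le
  rw [mul_assoc, h5, mul_one] at h6
  linarith

lemma tendsto_zero_atTop_of_deriv_le {D D' e : ℝ → ℝ} {k : ℝ} (hk : 0 < k)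
    (hD : ∀ t, HasDerivAt D (D' t) t) (h0 : ∀ t, 0 ≤ D t)
    (h : ∀ᶠ t in atTop, D' t ≤ -k * D t + e t) (he : Tendsto e atTop (𝓝 0)) :
    Tendsto D atTop (𝓝 0) := by
  rw [tendsto_order]
  refine ⟨fun a ha ↦ .of_forall fun t ↦ ha.trans_le (h0 t), fun a ha ↦ ?_⟩
  obtain ⟨T, hT⟩ := (h.and
    (he.eventually_le_const (show 0 < k * a / 2 by positivity))).exists_forall_of_atTop
  have hbound : ∀ t ≥ T, D t ≤ D T * Real.exp (-k * (t - T)) + a / 2 := by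
    intro t ht
    have h1 := le_exp_of_deriv_le (e := k * a / 2) hk hD
      (fun s hs ↦ (hT s hs.1).1.trans (by linarith [(hT s hs.1).2])) ht
    have h2 : k * a / 2 / k = a / 2 := by field_simp
    rw [h2] at h1
    nlinarith [Real.exp_pos (-k * (t - T))]
  have hlim : Tendsto (fun t ↦ D T * Real.exp (-k * (t - T))) atTop (𝓝 0) := by
    have h1 : Tendsto (fun t ↦ -k * (t - T)) atTop atBot :=
      (tendsto_atTop_add_const_right _ _ tendsto_id).const_mul_atTop_of_neg (by linarith)
    simpa using (Real.tendsto_exp_atBot.comp h1).const_mul (D T)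
  filter_upwards [eventually_ge_atTop T, hlim.eventually_lt_const (half_pos ha)] with t h1 h2
  linarith [hbound t h1]

/-- Backwards in time a contracting quantity can only stay bounded if it is as small as the
error term. -/
lemma tendsto_zero_atBot_of_deriv_le {D D' e : ℝ → ℝ} {k M : ℝ} (hk : 0 < k)
    (hD : ∀ t, HasDerivAt D (D' t) t) (h0 : ∀ t, 0 ≤ D t) (hM : ∀ t, D t ≤ M)
    (h : ∀ᶠ t in atBot, D' t ≤ -k * D t + e t) (he : Tendsto e atBot (𝓝 0)) :
    Tendsto D atBot (𝓝 0) := by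
  rw [tendsto_order]
  refine ⟨fun a ha ↦ .of_forall fun t ↦ ha.trans_le (h0 t), fun a ha ↦ ?_⟩
  obtain ⟨T, hT⟩ := (h.and
    (he.eventually_le_const (show 0 < k * (a / 2) by positivity))).exists_forall_of_atBot
  filter_upwards [eventually_le_atBot T] with t ht
  have hlim : Tendsto (fun s ↦ M * Real.exp (-k * (t - s)) + a / 2) atBot (𝓝 (a / 2)) := by
    have h1 : Tendsto (fun s ↦ -k * (t - s)) atBot atBot := by
      refine Tendsto.const_mul_atTop_of_neg (by linarith) ?_
      exact tendsto_atTop_add_const_left _ _ tendsto_neg_atBot_atTop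
    simpa using ((Real.tendsto_exp_atBot.comp h1).const_mul M).add_const (a / 2)
  refine (ge_of_tendsto hlim ?_).trans_lt (half_lt_self ha)
  filter_upwards [eventually_le_atBot t] with s hs
  have h1 := le_exp_of_deriv_le (e := k * (a / 2)) hk hD
      (fun s' hs' ↦ (hT s' (hs'.2.trans ht)).1.trans
        (by linarith [(hT s' (hs'.2.trans ht)).2])) hs
  have h2 : k * (a / 2) / k = a / 2 := by field_simp
  rw [h2] at h1
  have h3 := mul_le_mul_of_nonneg_right (show D s - a / 2 ≤ M by linarith [hM s])
    (Real.exp_pos (-k * (t - s))).le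
  linarith

lemma tendsto_of_le_deriv {q q' : ℝ → ℝ} {c : ℝ} (hc : 0 < c) (hq : ∀ t, HasDerivAt q (q' t) t)
    (h : ∀ t, c ≤ q' t) : Tendsto q atTop atTop ∧ Tendsto q atBot atBot := by
  have hmono : Monotone (fun t ↦ q t - c * t) := by
    refine monotone_of_hasDerivAt_nonneg (f' := fun t ↦ q' t - c) (fun t ↦ ?_)
      (fun t ↦ sub_nonneg.2 (h t))
    simpa using (hq t).fun_sub ((hasDerivAt_id t).const_mul c)
  constructor
  · refine tendsto_atTop_mono' _ ?_
      (tendsto_atTop_add_const_right _ (q 0) (tendsto_id.const_mul_atTop hc))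
    filter_upwards [eventually_ge_atTop 0] with t ht
    have := hmono ht
    simp only [mul_zero, sub_zero, id] at this ⊢
    linarith
  · refine tendsto_atBot_mono' _ ?_
      (tendsto_atBot_add_const_right _ (q 0) (tendsto_id.const_mul_atBot hc))
    filter_upwards [eventually_le_atBot 0] with t ht
    have := hmono ht
    simp only [mul_zero, sub_zero, id] at this ⊢
    linarith

/-! ### Connecting orbits of planar vector fields -/

/-- A planar vector field that leaves the axis `y = 0` invariant, points inwards along both boundary
circles of the annulus `3/4 ≤ r ≤ 5/4`, turns clockwise in the upper half of that annulus, and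
contracts the axis near its two intersections with the annulus. -/
structure IsTurningField (F : ℝ × ℝ → ℝ × ℝ) : Prop where
  axis : ∀ x, (F (x, 0)).2 = 0
  inner : ∀ p : ℝ × ℝ, p.1 ^ 2 + p.2 ^ 2 = 9 / 16 → 0 < p.1 * (F p).1 + p.2 * (F p).2
  outer : ∀ p : ℝ × ℝ, p.1 ^ 2 + p.2 ^ 2 = 25 / 16 → p.1 * (F p).1 + p.2 * (F p).2 < 0
  turn : ∃ c > 0, ∀ p : ℝ × ℝ, 0 ≤ p.2 → 9 / 16 ≤ p.1 ^ 2 + p.2 ^ 2 → p.1 ^ 2 + p.2 ^ 2 ≤ 25 / 16 →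
    p.1 * (F p).2 - p.2 * (F p).1 ≤ -c * p.2
  contract : ∃ k > 0, ∀ x x' : ℝ,
    (x ∈ Set.Icc (7 / 10) (13 / 10) ∧ x' ∈ Set.Icc (7 / 10) (13 / 10) ∨
      x ∈ Set.Icc (-13 / 10) (-7 / 10) ∧ x' ∈ Set.Icc (-13 / 10) (-7 / 10)) →
    (x - x') * ((F (x, 0)).1 - (F (x', 0)).1) ≤ -k * (x - x') ^ 2

/-- The conditions on a turning field concern its values near the annulus and on the axis only. -/
lemma IsTurningField.of_eq_on_ball {F G : ℝ × ℝ → ℝ × ℝ} (h : IsTurningField F)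
    (hG : ∀ x, (G (x, 0)).2 = 0) (hFG : ∀ p ∈ Metric.closedBall (0 : ℝ × ℝ) 2, G p = F p) :
    IsTurningField G := by
  have hmem : ∀ p : ℝ × ℝ, p.1 ^ 2 + p.2 ^ 2 ≤ 25 / 16 → G p = F p := by
    intro p hp
    refine hFG p ?_
    rw [mem_closedBall_zero_iff, Prod.norm_def, max_le_iff, Real.norm_eq_abs, Real.norm_eq_abs]
    exact ⟨abs_le_of_sq_le_sq (by nlinarith [sq_nonneg p.2]) (by norm_num),
      abs_le_of_sq_le_sq (by nlinarith [sq_nonneg p.1]) (by norm_num)⟩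
  obtain ⟨c, hc, hturn⟩ := h.turn
  obtain ⟨k, hk, hcon⟩ := h.contract
  refine ⟨hG, fun p hp ↦ ?_, fun p hp ↦ ?_, ⟨c, hc, fun p h0 h1 h2 ↦ ?_⟩, k, hk,
    fun x x' hx ↦ ?_⟩
  · rw [hmem p (by rw [hp]; norm_num)]
    exact h.inner p hp
  · rw [hmem p hp.le]
    exact h.outer p hp
  · rw [hmem p h2]
    exact hturn p h0 h1 h2
  · have hball : ∀ y : ℝ, |y| ≤ 2 → G (y, 0) = F (y, 0) := by
      intro y hy
      refine hFG _ ?_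
      rw [mem_closedBall_zero_iff, Prod.norm_def, max_le_iff]
      exact ⟨hy, by simp⟩
    have hxx : |x| ≤ 2 ∧ |x'| ≤ 2 := by
      rw [abs_le, abs_le]
      rcases hx with ⟨⟨h1, h2⟩, h3, h4⟩ | ⟨⟨h1, h2⟩, h3, h4⟩ <;>
        exact ⟨⟨by linarith, by linarith⟩, by linarith, by linarith⟩
    rw [hball x hxx.1, hball x' hxx.2]
    exact hcon x x' hx

lemma IsTurningField.exists_zeros {F : ℝ × ℝ → ℝ × ℝ} (h : IsTurningField F)
    (hF : Continuous F) :
    (∃ a ∈ Set.Ioo (-5 / 4 : ℝ) (-3 / 4), F (a, 0) = 0) ∧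
      ∃ b ∈ Set.Ioo (3 / 4 : ℝ) (5 / 4), F (b, 0) = 0 := by
  have hu : Continuous fun x : ℝ ↦ (F (x, 0)).1 := by fun_prop
  have h1 := h.inner (3 / 4, 0) (by norm_num)
  have h2 := h.outer (5 / 4, 0) (by norm_num)
  have h3 := h.inner (-3 / 4, 0) (by norm_num)
  have h4 := h.outer (-5 / 4, 0) (by norm_num)
  simp only [zero_mul, add_zero] at h1 h2 h3 h4
  constructor
  · obtain ⟨a, ha, ha'⟩ := intermediate_value_Ioo' (show (-5 / 4 : ℝ) ≤ -3 / 4 by norm_num)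
      hu.continuousOn (show (0 : ℝ) ∈ Set.Ioo _ _ from ⟨by linarith, by linarith⟩)
    exact ⟨a, ha, Prod.ext ha' (h.axis a)⟩
  · obtain ⟨b, hb, hb'⟩ := intermediate_value_Ioo' (show (3 / 4 : ℝ) ≤ 5 / 4 by norm_num)
      hu.continuousOn (show (0 : ℝ) ∈ Set.Ioo _ _ from ⟨by linarith, by linarith⟩)
    exact ⟨b, hb, Prod.ext hb' (h.axis b)⟩

lemma hasDerivAt_fst {γ : ℝ → ℝ × ℝ} {γ' : ℝ × ℝ} {t : ℝ} (h : HasDerivAt γ γ' t) :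
    HasDerivAt (fun t ↦ (γ t).1) γ'.1 t := by
  simpa using h.hasFDerivAt.fst.hasDerivAt

lemma hasDerivAt_snd {γ : ℝ → ℝ × ℝ} {γ' : ℝ × ℝ} {t : ℝ} (h : HasDerivAt γ γ' t) :
    HasDerivAt (fun t ↦ (γ t).2) γ'.2 t := by
  simpa using h.hasFDerivAt.snd.hasDerivAt

lemma hasDerivAt_sq_add_sq {F : ℝ × ℝ → ℝ × ℝ} {γ : ℝ → ℝ × ℝ} {t : ℝ}
    (h : HasDerivAt γ (F (γ t)) t) :
    HasDerivAt (fun t ↦ (γ t).1 ^ 2 + (γ t).2 ^ 2)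
      (2 * ((γ t).1 * (F (γ t)).1 + (γ t).2 * (F (γ t)).2)) t := by
  refine (((hasDerivAt_fst h).fun_pow 2).fun_add ((hasDerivAt_snd h).fun_pow 2)).congr_deriv ?_
  simp
  ring

/-- Of the orbits through the segment `x = 0`, `1/2 ≤ y ≤ 3/2`, those that leave the annulus
backwards in time through its inner circle, and those that leave it through the outer circle,
form two disjoint nonempty open sets. As the segment is connected, some orbit through it never
leaves the annulus. -/
lemma IsTurningField.exists_orbit_in_annulus {F : ℝ × ℝ → ℝ × ℝ} (h : IsTurningField F)
    {K C : NNReal} (hK : LipschitzWith K F) (hC : ∀ x, ‖F x‖ ≤ C) :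
    ∃ γ : ℝ → ℝ × ℝ, (∀ t, HasDerivAt γ (F (γ t)) t) ∧ 0 < (γ 0).2 ∧
      ∀ t, 9 / 16 ≤ (γ t).1 ^ 2 + (γ t).2 ^ 2 ∧ (γ t).1 ^ 2 + (γ t).2 ^ 2 ≤ 25 / 16 := by
  choose Φ hΦ0 hΦ using exists_global_solution hK hC
  let R : ℝ → ℝ → ℝ := fun s t ↦ (Φ (0, s) t).1 ^ 2 + (Φ (0, s) t).2 ^ 2
  have hR0 : ∀ s, R s 0 = s ^ 2 := by intro s; simp [R, hΦ0]
  have hinner : ∀ {s t₀ t}, t₀ ≤ t → 9 / 16 ≤ R s t₀ → 9 / 16 ≤ R s t := by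
    intro s t₀ t ht h₀
    have := le_of_deriv_neg_of_eq (c := -(9 / 16)) (t₀ := t₀)
      (fun t ↦ (hasDerivAt_sq_add_sq (hΦ (0, s) t)).fun_neg)
      (fun t ht ↦ ?_) (neg_le_neg h₀) ht
    · exact neg_le_neg_iff.1 this
    · linarith [h.inner _ (neg_injective ht)]
  have houter : ∀ {s t₀ t}, t₀ ≤ t → R s t₀ ≤ 25 / 16 → R s t ≤ 25 / 16 := by
    intro s t₀ t ht h₀
    refine le_of_deriv_neg_of_eq (c := 25 / 16) (t₀ := t₀)
      (fun t ↦ hasDerivAt_sq_add_sq (hΦ (0, s) t)) (fun t ht ↦ ?_) h₀ ht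
    linarith [h.outer _ ht]
  have hcont : ∀ t ≤ 0, Continuous fun s ↦ R s t := by
    intro t ht
    have h1 : LipschitzWith (Real.exp (K * -t)).toNNReal fun s : ℝ ↦ Φ (0, s) t := by
      refine LipschitzWith.of_dist_le_mul fun s s' ↦ ?_
      rw [Real.coe_toNNReal _ (Real.exp_pos _).le, mul_comm]
      refine (dist_le_of_solutions_of_nonpos hK (hΦ (0, s)) (hΦ (0, s')) ht).trans_eq ?_
      rw [hΦ0, hΦ0, Prod.dist_eq]
      simp
    have h2 := h1.continuous
    exact (h2.fst.pow 2).add (h2.snd.pow 2)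
  let A : Set ℝ := ⋃ t ∈ Set.Iic (0 : ℝ), {s | R s t < 9 / 16}
  let B : Set ℝ := ⋃ t ∈ Set.Iic (0 : ℝ), {s | 25 / 16 < R s t}
  have hA : IsOpen A := isOpen_biUnion fun t ht ↦ isOpen_lt (hcont t ht) continuous_const
  have hB : IsOpen B := isOpen_biUnion fun t ht ↦ isOpen_lt continuous_const (hcont t ht)
  have hAB : ¬ Set.Icc (1 / 2 : ℝ) (3 / 2) ⊆ A ∪ B := by
    intro hsub
    obtain ⟨s, -, hsA, hsB⟩ := isPreconnected_Icc A B hA hB hsub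
      ⟨1 / 2, by norm_num, Set.mem_biUnion (Set.mem_Iic.2 le_rfl) (by simp [hR0]; norm_num)⟩
      ⟨3 / 2, by norm_num, Set.mem_biUnion (Set.mem_Iic.2 le_rfl) (by simp [hR0]; norm_num)⟩
    simp only [A, B, Set.mem_iUnion, Set.mem_ofPred_eq] at hsA hsB
    obtain ⟨t₁, -, h1⟩ := hsA
    obtain ⟨t₂, -, h2⟩ := hsB
    have h3 : R s (min t₁ t₂) < 9 / 16 := by
      by_contra! hc
      exact h1.not_ge (hinner (min_le_left _ _) hc)
    have h4 : 25 / 16 < R s (min t₁ t₂) := by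
      by_contra! hc
      exact h2.not_ge (houter (min_le_right _ _) hc)
    linarith
  obtain ⟨s, hs, hsAB⟩ := Set.not_subset.1 hAB
  simp only [A, B, Set.mem_union, Set.mem_iUnion, Set.mem_ofPred_eq, Set.mem_Iic, not_or,
    not_exists, not_lt] at hsAB
  refine ⟨Φ (0, s), hΦ _, by rw [hΦ0]; linarith [hs.1], fun t ↦ ?_⟩
  rcases le_total t 0 with ht | ht
  · exact ⟨hsAB.1 t ht, hsAB.2 t ht⟩
  · exact ⟨hinner ht (hsAB.1 0 le_rfl), houter ht (hsAB.2 0 le_rfl)⟩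

/-- By uniqueness of solutions, an orbit that starts above the invariant axis stays above it. -/
lemma snd_pos_of_axis_invariant {F : ℝ × ℝ → ℝ × ℝ} (hax : ∀ x, (F (x, 0)).2 = 0) {K : NNReal}
    (hK : LipschitzWith K F) {γ : ℝ → ℝ × ℝ} (hγ : ∀ t, HasDerivAt γ (F (γ t)) t)
    (h0 : 0 < (γ 0).2) (t : ℝ) : 0 < (γ t).2 := by
  have hne : ∀ t, (γ t).2 ≠ 0 := by
    intro t ht
    have := ODE_solution_unique_univ (v := fun t y ↦ (F ((γ t).1, y)).2)
      (s := fun _ ↦ Set.univ) (K := K) (f := fun t ↦ (γ t).2) (g := fun _ ↦ 0) (t₀ := t)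
      (fun t ↦ ?_) (fun t ↦ ⟨hasDerivAt_snd (hγ t), trivial⟩)
      (fun t ↦ ⟨by simpa [hax] using hasDerivAt_const t (0 : ℝ), trivial⟩) ht
    · exact h0.ne' (congrFun this 0)
    · refine (LipschitzWith.of_dist_le_mul fun y y' ↦ ?_).lipschitzOnWith
      have h1 := hK.dist_le_mul ((γ t).1, y) ((γ t).1, y')
      rw [Prod.dist_eq (x := ((γ t).1, y)), dist_self, max_eq_right dist_nonneg] at h1
      exact (le_max_right _ _).trans h1
  by_contra! hc
  have hcont : Continuous fun t ↦ (γ t).2 :=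
    continuous_iff_continuousAt.2 fun t ↦ (hasDerivAt_snd (hγ t)).continuousAt
  obtain ⟨s, hs⟩ := mem_range_of_exists_le_of_exists_ge hcont ⟨t, hc⟩ ⟨0, h0.le⟩
  exact hne s hs

lemma IsTurningField.exists_connection_of_lipschitz {F : ℝ × ℝ → ℝ × ℝ} (h : IsTurningField F)
    {K C : NNReal} (hK : LipschitzWith K F) (hC : ∀ x, ‖F x‖ ≤ C) {a b : ℝ}
    (ha : a ∈ Set.Ioo (-5 / 4 : ℝ) (-3 / 4)) (hb : b ∈ Set.Ioo (3 / 4 : ℝ) (5 / 4))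
    (hFa : F (a, 0) = 0) (hFb : F (b, 0) = 0) :
    ∃ γ : ℝ → ℝ × ℝ, (∀ t, HasDerivAt γ (F (γ t)) t) ∧ (∀ t, 0 < (γ t).2) ∧
      (∀ t, γ t ∈ Metric.closedBall (0 : ℝ × ℝ) 2) ∧
      Tendsto γ atBot (𝓝 (a, 0)) ∧ Tendsto γ atTop (𝓝 (b, 0)) := by
  obtain ⟨γ, hγ, h0, hr⟩ := h.exists_orbit_in_annulus hK hC
  have hy := snd_pos_of_axis_invariant h.axis hK hγ h0
  obtain ⟨c, hc, hturn⟩ := h.turn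
  obtain ⟨k, hk, hcon⟩ := h.contract
  have hy2 : ∀ t, (γ t).2 ≤ 5 / 4 := fun t ↦ by nlinarith [(hr t).2, sq_nonneg (γ t).1]
  have hx2 : ∀ t, |(γ t).1| ≤ 5 / 4 := fun t ↦
    abs_le_of_sq_le_sq (by nlinarith [(hr t).2, sq_nonneg (γ t).2]) (by norm_num)
  -- The cotangent `x / y` of the polar angle grows at least linearly.
  have hq := tendsto_of_le_deriv (q := fun t ↦ (γ t).1 / (γ t).2) (c := c * (4 / 5)) (by positivity)
    (fun t ↦ (hasDerivAt_fst (hγ t)).fun_div (hasDerivAt_snd (hγ t)) (hy t).ne') (fun t ↦ by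
      have h1 := hturn (γ t) (hy t).le (hr t).1 (hr t).2
      rw [le_div_iff₀ (by have := hy t; positivity)]
      nlinarith [hy t, hy2 t, mul_le_mul_of_nonneg_left (hy2 t) (mul_pos hc (hy t)).le])
  have hylim : ∀ {l : Filter ℝ}, Tendsto (fun t ↦ ((γ t).1 / (γ t).2)⁻¹) l (𝓝 0) →
      (∀ᶠ t in l, (γ t).1 / (γ t).2 ≠ 0) → Tendsto (fun t ↦ (γ t).2) l (𝓝 0) := by
    intro l hl hne
    have h1 : Tendsto (fun t ↦ (γ t).1 * ((γ t).1 / (γ t).2)⁻¹) l (𝓝 0) :=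
      bdd_le_mul_tendsto_zero' (5 / 4) (.of_forall hx2) hl
    refine h1.congr' ?_
    filter_upwards [hne] with t ht
    have := left_ne_zero_of_mul ht
    rw [inv_div]
    field_simp
  have hyT : Tendsto (fun t ↦ (γ t).2) atTop (𝓝 0) :=
    hylim (tendsto_inv_atTop_zero.comp hq.1) (hq.1.eventually_ne_atTop 0)
  have hyB : Tendsto (fun t ↦ (γ t).2) atBot (𝓝 0) :=
    hylim (tendsto_inv_atBot_zero.comp hq.2) (hq.2.eventually_ne_atBot 0)
  have hD : ∀ d t, HasDerivAt (fun t ↦ ((γ t).1 - d) ^ 2)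
      (2 * (((γ t).1 - d) * (F (γ t)).1)) t := by
    intro d t
    refine (((hasDerivAt_fst (hγ t)).sub_const d).fun_pow 2).congr_deriv ?_
    simp
    ring
  -- The distance to an equilibrium contracts up to an error of the order of `y`.
  have hest : ∀ d t, F (d, 0) = 0 → |d| ≤ 2 →
      ((γ t).1 - d) * ((F ((γ t).1, 0)).1 - (F (d, 0)).1) ≤ -k * ((γ t).1 - d) ^ 2 →
      2 * (((γ t).1 - d) * (F (γ t)).1) ≤
        -(2 * k) * ((γ t).1 - d) ^ 2 + 8 * K * (γ t).2 := by
    intro d t hd hd2 hcd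
    have h1 : |(F (γ t)).1 - (F ((γ t).1, 0)).1| ≤ K * (γ t).2 := by
      have h2 := hK.dist_le_mul (γ t) ((γ t).1, 0)
      rw [Prod.dist_eq (x := γ t), dist_self, max_eq_right dist_nonneg, Real.dist_eq, sub_zero,
        abs_of_pos (hy t)] at h2
      exact (le_max_left _ _).trans h2
    have h3 : |(γ t).1 - d| ≤ 4 := (abs_sub _ _).trans (by linarith [hx2 t])
    have h4 : ((γ t).1 - d) * ((F (γ t)).1 - (F ((γ t).1, 0)).1) ≤ 4 * (K * (γ t).2) := by
      refine (le_abs_self _).trans ?_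
      rw [abs_mul]
      exact mul_le_mul h3 h1 (abs_nonneg _) (by norm_num)
    rw [hd, Prod.fst_zero, sub_zero] at hcd
    nlinarith
  have hclose : ∀ {l : Filter ℝ}, Tendsto (fun t ↦ (γ t).2) l (𝓝 0) →
      ∀ᶠ t in l, (7 / 10) ^ 2 ≤ (γ t).1 ^ 2 := by
    intro l hl
    have h1 : Tendsto (fun t ↦ (γ t).2 ^ 2) l (𝓝 0) := by simpa using hl.pow 2
    filter_upwards [h1.eventually_le_const (show (0 : ℝ) < 1 / 20 by norm_num)] with t ht
    linarith [(hr t).1]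
  have hnear : ∀ {l : Filter ℝ} {d : ℝ}, Tendsto (fun t ↦ (γ t).2) l (𝓝 0) →
      Tendsto (fun t ↦ ((γ t).1 - d) ^ 2) l (𝓝 0) → Tendsto γ l (𝓝 (d, 0)) := by
    intro l d hl hd
    have h1 : Tendsto (fun t ↦ (γ t).1 - d) l (𝓝 0) := by
      rw [tendsto_zero_iff_abs_tendsto_zero]
      simpa [Function.comp_def, Real.sqrt_sq_eq_abs] using
        (Real.continuous_sqrt.tendsto 0).comp hd
    have h2 : Tendsto (fun t ↦ (γ t).1) l (𝓝 d) := by simpa using h1.add_const d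
    exact h2.prodMk_nhds hl
  have herr : ∀ {l : Filter ℝ}, Tendsto (fun t ↦ (γ t).2) l (𝓝 0) →
      Tendsto (fun t ↦ 8 * K * (γ t).2) l (𝓝 0) := by
    intro l hl
    simpa using hl.const_mul (8 * K : ℝ)
  refine ⟨γ, hγ, hy, fun t ↦ ?_, hnear hyB ?_, hnear hyT ?_⟩
  · rw [mem_closedBall_zero_iff, Prod.norm_def, max_le_iff, Real.norm_eq_abs, Real.norm_eq_abs,
      abs_of_pos (hy t)]
    exact ⟨(hx2 t).trans (by norm_num), (hy2 t).trans (by norm_num)⟩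
  · refine tendsto_zero_atBot_of_deriv_le (M := 16) (k := 2 * k) (by positivity) (hD a)
      (fun t ↦ sq_nonneg _) (fun t ↦ ?_) ?_ (herr hyB)
    · have := abs_le.1 (hx2 t)
      nlinarith [ha.1, ha.2]
    · filter_upwards [hclose hyB, hq.2.eventually_lt_atBot 0] with t h1 h2
      have hneg : (γ t).1 < 0 := by
        by_contra! hcc
        exact h2.not_ge (div_nonneg hcc (hy t).le)
      refine hest a t hFa (abs_le.2 ⟨by linarith [ha.1], by linarith [ha.2]⟩)
        (hcon _ _ (.inr ⟨⟨?_, ?_⟩, ?_, ?_⟩))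
      · linarith [(abs_le.1 (hx2 t)).1]
      · nlinarith
      · linarith [ha.1]
      · linarith [ha.2]
  · refine tendsto_zero_atTop_of_deriv_le (k := 2 * k) (by positivity) (hD b)
      (fun t ↦ sq_nonneg _) ?_ (herr hyT)
    filter_upwards [hclose hyT, hq.1.eventually_gt_atTop 0] with t h1 h2
    have hpos : 0 < (γ t).1 := by
      by_contra! hcc
      exact h2.not_ge (div_nonpos_of_nonpos_of_nonneg hcc (hy t).le)
    refine hest b t hFb (abs_le.2 ⟨by linarith [hb.1], by linarith [hb.2]⟩)
      (hcon _ _ (.inl ⟨⟨?_, ?_⟩, ?_, ?_⟩))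
    · nlinarith
    · linarith [(abs_le.1 (hx2 t)).2]
    · linarith [hb.1]
    · linarith [hb.2]

/-- A smooth turning field has an orbit above the axis that connects its two equilibria on the axis
near the annulus. -/
theorem IsTurningField.exists_connection {F : ℝ × ℝ → ℝ × ℝ} (h : IsTurningField F)
    (hF : ContDiff ℝ ∞ F) {a b : ℝ}
    (ha : a ∈ Set.Ioo (-5 / 4 : ℝ) (-3 / 4)) (hb : b ∈ Set.Ioo (3 / 4 : ℝ) (5 / 4))
    (hFa : F (a, 0) = 0) (hFb : F (b, 0) = 0) :
    ∃ γ : ℝ → ℝ × ℝ, (∀ t, HasDerivAt γ (F (γ t)) t) ∧ (∀ t, 0 < (γ t).2) ∧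
      Tendsto γ atBot (𝓝 (a, 0)) ∧ Tendsto γ atTop (𝓝 (b, 0)) := by
  -- Multiplication by a bump function makes the field bounded and globally Lipschitz.
  let χ : ContDiffBump (0 : ℝ × ℝ) := ⟨2, 3, by norm_num, by norm_num⟩
  let G : ℝ × ℝ → ℝ × ℝ := fun p ↦ χ p • F p
  have hGF : ∀ p ∈ Metric.closedBall (0 : ℝ × ℝ) 2, G p = F p := by
    intro p hp
    simp only [G]
    rw [χ.one_of_mem_closedBall hp, one_smul]
  have hGsmooth : ContDiff ℝ ∞ G := χ.contDiff.smul hF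
  have hGsupp : HasCompactSupport G := χ.hasCompactSupport.smul_right
  obtain ⟨K, hK⟩ := ContDiff.lipschitzWith_of_hasCompactSupport hGsupp hGsmooth (by simp)
  obtain ⟨C, hC⟩ := hGsupp.exists_bound_of_continuous hGsmooth.continuous
  have hG : IsTurningField G := h.of_eq_on_ball (fun x ↦ by simp [G, h.axis]) hGF
  obtain ⟨γ, h1, h2, h3, h4, h5⟩ := hG.exists_connection_of_lipschitz hK (C := C.toNNReal)
    (fun x ↦ (hC x).trans (Real.le_coe_toNNReal C)) ha hb (by simp [G, hFa]) (by simp [G, hFb])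
  exact ⟨γ, fun t ↦ hGF _ (h3 t) ▸ h1 t, h2, h4, h5⟩

/-! ### Representations of dihedral groups by generators -/

/-- The homomorphism from the dihedral group of order `2 * n` that is determined by the images
`a` and `b` of the rotation `r 1` and of the reflection `sr 0`. -/
def dihedralLift {G : Type*} [Group G] {n : ℕ} [NeZero n] (a b : G) (ha : a ^ n = 1)
    (hb : b * b = 1) (hab : b * a * b = a⁻¹) : DihedralGroup n →* G :=
  have hadd : ∀ i j : ZMod n, a ^ (i + j).val = a ^ i.val * a ^ j.val := fun i j ↦ by
    rw [← pow_add]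
    refine pow_eq_pow_of_modEq ?_ ha
    rw [← ZMod.natCast_eq_natCast_iff]
    simp
  have hsub : ∀ i j : ZMod n, a ^ (j - i).val = (a ^ i.val)⁻¹ * a ^ j.val := fun i j ↦ by
    rw [eq_inv_mul_iff_mul_eq, ← hadd]
    congr 2
    ring
  have hconj : ∀ k : ℕ, b * a ^ k = (a ^ k)⁻¹ * b := fun k ↦ by
    have h : SemiconjBy b a a⁻¹ := by
      rw [SemiconjBy, ← hab, mul_assoc (b * a), hb, mul_one]
    rw [← inv_pow]
    exact h.pow_right k
  have hconj' : ∀ k : ℕ, a ^ k * b = b * (a ^ k)⁻¹ := fun k ↦ by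
    rw [eq_mul_inv_iff_mul_eq, mul_assoc, hconj, mul_inv_cancel_left]
  MonoidHom.mk'
    (fun
      | .r i => a ^ i.val
      | .sr i => b * a ^ i.val)
    (by
      rintro (i | i) (j | j)
      · simp only [DihedralGroup.r_mul_r, hadd]
      · simp only [DihedralGroup.r_mul_sr, hsub]
        rw [← mul_assoc, ← mul_assoc, hconj']
      · simp only [DihedralGroup.sr_mul_r, hadd, mul_assoc]
      · simp only [DihedralGroup.sr_mul_sr, hsub]
        rw [← mul_assoc, hconj, mul_assoc _ b b, hb, mul_one])

@[simp] lemma dihedralLift_r {G : Type*} [Group G] {n : ℕ} [NeZero n] {a b : G} (ha : a ^ n = 1)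
    (hb : b * b = 1) (hab : b * a * b = a⁻¹) (i : ZMod n) :
    dihedralLift a b ha hb hab (.r i) = a ^ i.val := rfl

@[simp] lemma dihedralLift_sr {G : Type*} [Group G] {n : ℕ} [NeZero n] {a b : G} (ha : a ^ n = 1)
    (hb : b * b = 1) (hab : b * a * b = a⁻¹) (i : ZMod n) :
    dihedralLift a b ha hb hab (.sr i) = b * a ^ i.val := rfl

lemma range_dihedralLift {G : Type*} [Group G] {n : ℕ} [NeZero n] {a b : G} (ha : a ^ n = 1)
    (hb : b * b = 1) (hab : b * a * b = a⁻¹) :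
    (dihedralLift a b ha hb hab).range = Subgroup.closure {a, b} := by
  have ha' : a ∈ Subgroup.closure {a, b} := Subgroup.subset_closure (by simp)
  have hb' : b ∈ Subgroup.closure {a, b} := Subgroup.subset_closure (by simp)
  refine le_antisymm ?_ ((Subgroup.closure_le _).2 ?_)
  · rintro _ ⟨i | i, rfl⟩
    · exact pow_mem ha' _
    · exact mul_mem hb' (pow_mem ha' _)
  · rw [Set.insert_subset_iff, Set.singleton_subset_iff]
    constructor
    · refine ⟨.r 1, ?_⟩
      rw [dihedralLift_r]
      refine (pow_eq_pow_of_modEq ?_ ha).trans (pow_one a)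
      rw [← ZMod.natCast_eq_natCast_iff]
      simp
    · exact ⟨.sr 0, by simp⟩

/-! ### The dihedral group generated by `ρ` and `κ` -/

/-- The primitive cube root of unity by which `ρ` acts on the `z₂`-plane. -/
noncomputable def omega : ℂ := Complex.exp (2 * Real.pi * Complex.I / 3)

lemma omega_eq : omega = ⟨-1 / 2, Real.sqrt 3 / 2⟩ := by
  have h : (2 * Real.pi * Complex.I / 3 : ℂ) = ((2 * Real.pi / 3 : ℝ) : ℂ) * Complex.I := by
    push_cast
    ring
  have h2 : 2 * Real.pi / 3 = Real.pi - Real.pi / 3 := by ring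
  rw [omega, h, Complex.exp_mul_I, ← Complex.ofReal_cos, ← Complex.ofReal_sin, h2,
    Real.cos_pi_sub, Real.sin_pi_sub, Real.cos_pi_div_three, Real.sin_pi_div_three]
  apply Complex.ext <;> simp
  norm_num

lemma omega_isPrimitiveRoot : IsPrimitiveRoot omega 3 := by
  simpa [omega] using! Complex.isPrimitiveRoot_exp 3 (by norm_num)

lemma conj_omega_mul_omega : (starRingEnd ℂ) omega * omega = 1 := by
  rw [omega_eq]
  have h : Real.sqrt 3 * Real.sqrt 3 = 3 := Real.mul_self_sqrt (by norm_num)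
  apply Complex.ext <;> simp
  · linarith
  · ring

lemma ext_z {v w : E4} (h1 : z1 v = z1 w) (h2 : z2 v = z2 w) : v = w := by
  rw [← ofComplex_z v, ← ofComplex_z w, h1, h2]

lemma z1_rho (v : E4) : z1 (rho v) = z1 v := by rw [rho_apply, z1_ofComplex]

lemma z2_rho (v : E4) : z2 (rho v) = omega * z2 v := by rw [rho_apply, z2_ofComplex, omega]

lemma z1_kappa (v : E4) : z1 (kappa v) = (starRingEnd ℂ) (z1 v) := by
  rw [kappa_apply, z1_ofComplex]

lemma z2_kappa (v : E4) : z2 (kappa v) = (starRingEnd ℂ) (z2 v) := by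
  rw [kappa_apply, z2_ofComplex]

lemma z1_rho_pow (n : ℕ) (v : E4) : z1 ((rho ^ n) v) = z1 v := by
  induction n with
  | zero => simp
  | succ n ih => rw [pow_succ', LinearIsometryEquiv.coe_mul, Function.comp_apply, z1_rho, ih]

lemma z2_rho_pow (n : ℕ) (v : E4) : z2 ((rho ^ n) v) = omega ^ n * z2 v := by
  induction n with
  | zero => simp
  | succ n ih =>
    rw [pow_succ', LinearIsometryEquiv.coe_mul, Function.comp_apply, z2_rho, ih, pow_succ']
    ring

lemma rho_pow_three : rho ^ 3 = 1 := by
  refine LinearIsometryEquiv.ext fun v ↦ ext_z (z1_rho_pow 3 v) ?_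
  rw [z2_rho_pow, omega_isPrimitiveRoot.pow_eq_one, one_mul]
  rfl

lemma kappa_mul_kappa : kappa * kappa = 1 := by
  refine LinearIsometryEquiv.ext fun v ↦ ext_z ?_ ?_ <;>
    rw [LinearIsometryEquiv.coe_mul, Function.comp_apply]
  · rw [z1_kappa, z1_kappa, Complex.conj_conj]
    rfl
  · rw [z2_kappa, z2_kappa, Complex.conj_conj]
    rfl

lemma kappa_mul_rho_mul_kappa : kappa * rho * kappa = rho⁻¹ := by
  rw [eq_inv_iff_mul_eq_one]
  refine LinearIsometryEquiv.ext fun v ↦ ext_z ?_ ?_ <;>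
    simp only [LinearIsometryEquiv.coe_mul, Function.comp_apply]
  · rw [z1_kappa, z1_rho, z1_kappa, Complex.conj_conj, z1_rho]
    rfl
  · rw [z2_kappa, z2_rho, z2_kappa, z2_rho, map_mul, Complex.conj_conj, ← mul_assoc,
      conj_omega_mul_omega, one_mul]
    rfl

lemma rho_mem : rho ∈ Gam := Subgroup.subset_closure (by simp)

lemma kappa_mem : kappa ∈ Gam := Subgroup.subset_closure (by simp)

lemma mem_Gam_cases {γ : O4} (h : γ ∈ Gam) :
    ∃ i : ZMod 3, γ = rho ^ i.val ∨ γ = kappa * rho ^ i.val := by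
  rw [Gam, ← range_dihedralLift rho_pow_three kappa_mul_kappa kappa_mul_rho_mul_kappa] at h
  obtain ⟨i | i, rfl⟩ := h
  · exact ⟨i, .inl rfl⟩
  · exact ⟨i, .inr rfl⟩

lemma omega_pow_val_eq_one {i : ZMod 3} (h : omega ^ i.val = 1) : i = 0 := by
  rw [← ZMod.val_eq_zero]
  exact Nat.eq_zero_of_dvd_of_lt (omega_isPrimitiveRoot.dvd_of_pow_eq_one _ h) i.val_lt

lemma z1_kappa_mul_rho_pow (n : ℕ) (v : E4) :
    z1 ((kappa * rho ^ n) v) = (starRingEnd ℂ) (z1 v) := by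
  rw [LinearIsometryEquiv.coe_mul, Function.comp_apply, z1_kappa, z1_rho_pow]

lemma z2_kappa_mul_rho_pow (n : ℕ) (v : E4) :
    z2 ((kappa * rho ^ n) v) = (starRingEnd ℂ) (omega ^ n * z2 v) := by
  rw [LinearIsometryEquiv.coe_mul, Function.comp_apply, z2_kappa, z2_rho_pow]

lemma kappa_mul_rho_pow_ne (n : ℕ) {w : ℂ} :
    (kappa * rho ^ n) (ofComplex Complex.I w) ≠ ofComplex Complex.I w := by
  intro h
  have h1 := congrArg z1 h
  rw [z1_kappa_mul_rho_pow, z1_ofComplex] at h1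
  have h2 := congrArg Complex.im h1
  norm_num at h2

lemma dihedralLift_rho_kappa_injective :
    Function.Injective
      (dihedralLift rho kappa rho_pow_three kappa_mul_kappa kappa_mul_rho_mul_kappa) := by
  rw [injective_iff_map_eq_one]
  rintro (i | i) h
  · have h1 : (rho ^ i.val) (ofComplex 0 1) = ofComplex 0 1 := by
      rw [dihedralLift_r] at h
      rw [h]
      rfl
    have h2 := congrArg z2 h1
    rw [z2_rho_pow, z2_ofComplex, mul_one] at h2
    rw [omega_pow_val_eq_one h2]
    rfl
  · rw [dihedralLift_sr] at h
    exact absurd (by rw [h]; rfl) (kappa_mul_rho_pow_ne i.val (w := 0))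

theorem nonempty_mulEquiv_dihedralGroup : Nonempty (Gam ≃* DihedralGroup 3) :=
  ⟨((MonoidHom.ofInjective dihedralLift_rho_kappa_injective).trans
    (MulEquiv.subgroupCongr (range_dihedralLift _ _ _))).symm⟩

/-! ### Orientation -/

lemma det_mul (γ δ : O4) :
    LinearMap.det ((γ * δ).toLinearEquiv : E4 →ₗ[ℝ] E4) =
      LinearMap.det (γ.toLinearEquiv : E4 →ₗ[ℝ] E4) *
        LinearMap.det (δ.toLinearEquiv : E4 →ₗ[ℝ] E4) := by
  rw [← LinearMap.det_comp]
  rfl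

lemma det_one : LinearMap.det ((1 : O4).toLinearEquiv : E4 →ₗ[ℝ] E4) = 1 :=
  LinearMap.det_id

lemma det_rho : LinearMap.det (rho.toLinearEquiv : E4 →ₗ[ℝ] E4) = 1 := by
  have h := det_one
  rw [← rho_pow_three, pow_three, det_mul, det_mul] at h
  exact (pow_eq_one_iff_of_ne_zero (n := 3) (by norm_num)).1 (by linarith) |>.resolve_right
    (by norm_num)

lemma det_kappa : LinearMap.det (kappa.toLinearEquiv : E4 →ₗ[ℝ] E4) = 1 := by
  let b := (EuclideanSpace.basisFun (Fin 4) ℝ).toBasis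
  have h : LinearMap.toMatrix b b (kappa.toLinearEquiv : E4 →ₗ[ℝ] E4) =
      Matrix.diagonal ![1, -1, 1, -1] := by
    ext i j
    rw [LinearMap.toMatrix_apply]
    fin_cases i <;> fin_cases j <;> simp [b, kappa_apply, ofComplex, z1, z2]
  rw [← LinearMap.det_toMatrix b, h, Matrix.det_diagonal]
  simp [Fin.prod_univ_four]

lemma det_eq_one {γ : O4} (h : γ ∈ Gam) :
    LinearMap.det (γ.toLinearEquiv : E4 →ₗ[ℝ] E4) = 1 := by
  induction h using Subgroup.closure_induction with
  | mem x hx =>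
    rcases hx with rfl | rfl
    · exact det_rho
    · exact det_kappa
  | one => exact det_one
  | mul x y _ _ hx hy => rw [det_mul, hx, hy, one_mul]
  | inv x _ hx =>
    have h1 := det_one
    rwa [← inv_mul_cancel x, det_mul, hx, mul_one] at h1

/-! ### Fixed-point subspaces and isotropy subgroups -/

/-- The basis vector `e i` of `ℝ⁴`. -/
noncomputable abbrev basisVec (i : Fin 4) : E4 := EuclideanSpace.single i 1

/-- The coordinate subspace spanned by the basis vectors `e i` and `e j`. -/
def coordPlane (i j : Fin 4) : Submodule ℝ E4 where
  carrier := {v | ∀ k, k ≠ i → k ≠ j → v k = 0}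
  add_mem' := by
    intro v w hv hw k hi hj
    rw [PiLp.add_apply, hv k hi hj, hw k hi hj, add_zero]
  zero_mem' := fun _ _ _ ↦ rfl
  smul_mem' := by
    intro c v hv k hi hj
    rw [PiLp.smul_apply, hv k hi hj, smul_zero]

lemma mem_coordPlane {i j : Fin 4} {v : E4} :
    v ∈ coordPlane i j ↔ ∀ k, k ≠ i → k ≠ j → v k = 0 := Iff.rfl

/-- The coordinates `(v i, v j)` on a coordinate plane. -/
noncomputable def coordPlaneEquiv {i j : Fin 4} (hij : i ≠ j) :
    coordPlane i j ≃ₗ[ℝ] (Fin 2 → ℝ) where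
  toFun v := ![v.1 i, v.1 j]
  invFun w := ⟨w 0 • basisVec i + w 1 • basisVec j, fun k hi hj ↦ by simp [hi, hj]⟩
  map_add' v w := by
    ext k
    fin_cases k <;> simp
  map_smul' c v := by
    ext k
    fin_cases k <;> simp
  left_inv v := by
    ext k
    by_cases hi : k = i
    · subst hi
      simp [hij]
    · by_cases hj : k = j
      · subst hj
        simp [hi]
      · simp [hi, hj, v.2 k hi hj]
  right_inv w := by
    ext k
    fin_cases k <;> simp [hij, hij.symm]

lemma finrank_coordPlane {i j : Fin 4} (hij : i ≠ j) :
    Module.finrank ℝ (coordPlane i j) = 2 := by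
  rw [(coordPlaneEquiv hij).finrank_eq]
  simp

lemma mem_fixedSpace_closure {s : Set O4} {v : E4} :
    v ∈ fixedSpace (Subgroup.closure s) ↔ ∀ g ∈ s, g v = v := by
  refine ⟨fun hv g hg ↦ hv g (Subgroup.subset_closure hg), fun hv γ hγ ↦ ?_⟩
  induction hγ using Subgroup.closure_induction with
  | mem x hx => exact hv x hx
  | one => rfl
  | mul x y _ _ hx hy => rw [LinearIsometryEquiv.coe_mul, Function.comp_apply, hy, hx]
  | inv x _ hx => exact (LinearIsometryEquiv.symm_apply_eq x).2 hx.symm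

lemma mem_fixedSpace_zpowers {g : O4} {v : E4} :
    v ∈ fixedSpace (Subgroup.zpowers g) ↔ g v = v := by
  rw [Subgroup.zpowers_eq_closure, mem_fixedSpace_closure]
  simp

lemma mem_fixedSpace_closure_pair {g h : O4} {v : E4} :
    v ∈ fixedSpace (Subgroup.closure {g, h}) ↔ g v = v ∧ h v = v := by
  rw [mem_fixedSpace_closure]
  simp

lemma z2_eq_zero_iff {v : E4} : z2 v = 0 ↔ v 2 = 0 ∧ v 3 = 0 := by
  rw [Complex.ext_iff]
  rfl

lemma rho_apply_eq_self_iff {v : E4} : rho v = v ↔ v 2 = 0 ∧ v 3 = 0 := by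
  rw [← z2_eq_zero_iff]
  refine ⟨fun h ↦ ?_, fun h ↦ ext_z (z1_rho v) (by rw [z2_rho, h, mul_zero])⟩
  have h1 := congrArg z2 h
  rw [z2_rho] at h1
  by_contra h0
  exact omega_isPrimitiveRoot.ne_one (by norm_num) ((mul_eq_right₀ h0).1 h1)

lemma kappa_apply_coord (v : E4) :
    kappa v 0 = v 0 ∧ kappa v 1 = -v 1 ∧ kappa v 2 = v 2 ∧ kappa v 3 = -v 3 :=
  ⟨rfl, rfl, rfl, rfl⟩

lemma rho_apply_coord (v : E4) :
    rho v 0 = v 0 ∧ rho v 1 = v 1 ∧ rho v 2 = -1 / 2 * v 2 - Real.sqrt 3 / 2 * v 3 ∧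
      rho v 3 = -1 / 2 * v 3 + Real.sqrt 3 / 2 * v 2 := by
  have h1 := z1_rho v
  have h2 := z2_rho v
  rw [omega_eq] at h2
  rw [Complex.ext_iff] at h1 h2
  simp only [z1, z2, Complex.mul_re, Complex.mul_im] at h1 h2
  exact ⟨h1.1, h1.2, h2.1, h2.2⟩

lemma kappa_apply_eq_self_iff {v : E4} : kappa v = v ↔ v 1 = 0 ∧ v 3 = 0 := by
  obtain ⟨h0, h1, h2, h3⟩ := kappa_apply_coord v
  constructor
  · intro h
    rw [h] at h1 h3
    exact ⟨by linarith, by linarith⟩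
  · rintro ⟨h1', h3'⟩
    ext k
    fin_cases k
    · exact h0
    · exact h1.trans (by simp [h1'])
    · exact h2
    · exact h3.trans (by simp [h3'])

lemma fixedSpace_rho : fixedSpace (Subgroup.zpowers rho) = coordPlane 0 1 := by
  ext v
  rw [mem_fixedSpace_zpowers, rho_apply_eq_self_iff, mem_coordPlane]
  simp [Fin.forall_fin_succ]

lemma fixedSpace_kappa : fixedSpace (Subgroup.zpowers kappa) = coordPlane 0 2 := by
  ext v
  rw [mem_fixedSpace_zpowers, kappa_apply_eq_self_iff, mem_coordPlane]
  simp [Fin.forall_fin_succ]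

lemma mem_fixedSpace_Gam {v : E4} : v ∈ fixedSpace Gam ↔ v 1 = 0 ∧ v 2 = 0 ∧ v 3 = 0 := by
  rw [Gam, mem_fixedSpace_closure_pair, rho_apply_eq_self_iff, kappa_apply_eq_self_iff]
  tauto

lemma fixedSpace_Gam_eq_inf :
    fixedSpace Gam = fixedSpace (Subgroup.zpowers rho) ⊓ fixedSpace (Subgroup.zpowers kappa) := by
  ext v
  rw [Submodule.mem_inf, mem_fixedSpace_zpowers, mem_fixedSpace_zpowers, Gam,
    mem_fixedSpace_closure_pair]

/-- The point `(x, 0, 0, 0)`. -/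
noncomputable def axisPoint (x : ℝ) : E4 := x • basisVec 0

lemma axisPoint_coord (x : ℝ) :
    axisPoint x 0 = x ∧ axisPoint x 1 = 0 ∧ axisPoint x 2 = 0 ∧ axisPoint x 3 = 0 := by
  simp [axisPoint]

lemma axisPoint_mem (x : ℝ) : axisPoint x ∈ fixedSpace Gam :=
  mem_fixedSpace_Gam.2 (axisPoint_coord x).2

lemma fixedSpace_Gam_eq_span : fixedSpace Gam = Submodule.span ℝ {basisVec 0} := by
  ext v
  rw [Submodule.mem_span_singleton]
  constructor
  · intro h
    obtain ⟨h1, h2, h3⟩ := mem_fixedSpace_Gam.1 h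
    refine ⟨v 0, ?_⟩
    ext k
    fin_cases k <;> simp [h1, h2, h3]
  · rintro ⟨x, rfl⟩
    exact axisPoint_mem x

lemma finrank_fixedSpace_Gam : Module.finrank ℝ (fixedSpace Gam) = 1 := by
  rw [fixedSpace_Gam_eq_span]
  refine finrank_span_singleton fun h ↦ ?_
  simpa using congrArg (fun v : E4 ↦ v 0) h

lemma isotropy_axisPoint (x : ℝ) : isotropy Gam (axisPoint x) = Gam :=
  le_antisymm (fun _ h ↦ h.1) (fun _ h ↦ ⟨h, axisPoint_mem x _ h⟩)

lemma isIsotropySubgroup_rho : IsIsotropySubgroup Gam (Subgroup.zpowers rho) := by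
  refine ⟨ofComplex Complex.I 0, le_antisymm ?_ ?_⟩
  · rw [Subgroup.zpowers_le]
    refine ⟨rho_mem, ext_z (z1_rho _) ?_⟩
    rw [z2_rho, z2_ofComplex, mul_zero]
  · rintro γ ⟨hγ, hfix⟩
    obtain ⟨i, rfl | rfl⟩ := mem_Gam_cases hγ
    · exact pow_mem (Subgroup.mem_zpowers rho) _
    · exact absurd hfix (kappa_mul_rho_pow_ne _)

lemma isIsotropySubgroup_kappa : IsIsotropySubgroup Gam (Subgroup.zpowers kappa) := by
  refine ⟨ofComplex 0 1, le_antisymm ?_ ?_⟩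
  · rw [Subgroup.zpowers_le]
    refine ⟨kappa_mem, ext_z ?_ ?_⟩
    · rw [z1_kappa, z1_ofComplex, map_zero]
    · rw [z2_kappa, z2_ofComplex, map_one]
  · rintro γ ⟨hγ, hfix⟩
    have h2 := congrArg z2 hfix
    obtain ⟨i, rfl | rfl⟩ := mem_Gam_cases hγ
    · rw [z2_rho_pow, z2_ofComplex, mul_one] at h2
      rw [omega_pow_val_eq_one h2, ZMod.val_zero, pow_zero]
      exact one_mem _
    · rw [z2_kappa_mul_rho_pow, z2_ofComplex, mul_one,
        map_eq_one_iff _ (starRingEnd ℂ).injective] at h2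
      rw [omega_pow_val_eq_one h2, ZMod.val_zero, pow_zero, mul_one]
      exact Subgroup.mem_zpowers kappa

/-! ### The isotypic decomposition -/

lemma mem_z2Plane {v : E4} : v ∈ z2Plane ↔ v 0 = 0 ∧ v 1 = 0 := Iff.rfl

lemma mem_z2Plane_iff_z1 {v : E4} : v ∈ z2Plane ↔ z1 v = 0 := by
  rw [Complex.ext_iff]
  rfl

/-- The `z₂`-plane as a subrepresentation of the natural representation of `Γ`. -/
noncomputable def z2Subrep : Subrepresentation (naturalRep Gam) where
  toSubmodule := z2Plane
  apply_mem_toSubmodule := by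
    rintro ⟨γ, hγ⟩ v hv
    rw [mem_z2Plane_iff_z1] at hv ⊢
    change z1 (γ v) = 0
    obtain ⟨i, rfl | rfl⟩ := mem_Gam_cases hγ
    · rw [z1_rho_pow, hv]
    · rw [z1_kappa_mul_rho_pow, hv, map_zero]

/-- In the `z₂`-plane, any nonzero vector and its image under `ρ` span. -/
lemma exists_eq_smul_add_smul_rho {v w : E4} (hv : v ∈ z2Plane) (hv0 : v ≠ 0)
    (hw : w ∈ z2Plane) : ∃ α β : ℝ, w = α • v + β • rho v := by
  rw [mem_z2Plane_iff_z1] at hv hw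
  have hz : z2 v ≠ 0 := fun h ↦ hv0 (ext_z (by rw [hv]; rfl) (by rw [h]; rfl))
  have hs : Real.sqrt 3 ≠ 0 := by positivity
  set q := z2 w / z2 v with hq
  refine ⟨q.re + q.im / Real.sqrt 3, 2 * q.im / Real.sqrt 3, ext_z ?_ ?_⟩
  · rw [z1_add, z1_smul, z1_smul, z1_rho, hv, hw, smul_zero, smul_zero, add_zero]
  · rw [z2_add, z2_smul, z2_smul, z2_rho, Complex.real_smul, Complex.real_smul, ← mul_assoc,
      ← add_mul, ← div_eq_iff hz, ← hq, omega_eq]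
    apply Complex.ext <;> simp
    · ring
    · field_simp

lemma isSimpleModule_z2Subrep :
    IsSimpleModule (MonoidAlgebra ℝ Gam) (Subrepresentation.asSubmodule z2Subrep) := by
  rw [isSimpleModule_iff_isAtom]
  refine ⟨fun h ↦ ?_, fun N hN ↦ ?_⟩
  · have h1 : (basisVec 2 : E4) ∈ Subrepresentation.asSubmodule z2Subrep :=
      mem_z2Plane.2 ⟨by simp, by simp⟩
    rw [h] at h1
    have h2 : (basisVec 2 : E4) = 0 := 
      (Submodule.mem_bot (M := (naturalRep Gam).asModule) (MonoidAlgebra ℝ Gam)).1 h1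
    simpa using congrArg (fun v : E4 ↦ v 2) h2
  · by_contra hne
    obtain ⟨v, hvN, hv0⟩ := Submodule.exists_mem_ne_zero_of_ne_bot hne
    refine hN.not_ge fun w hw ↦ ?_
    obtain ⟨α, β, rfl⟩ := exists_eq_smul_add_smul_rho (hN.le hvN) hv0 hw
    have hsmul : ∀ (g : Gam) (c : ℝ), c • (naturalRep Gam g v : E4) ∈ N := by
      intro g c
      have h1 := N.smul_mem (MonoidAlgebra.single g c) hvN
      rwa [Representation.single_smul] at h1
    exact N.add_mem (hsmul 1 α) (hsmul ⟨rho, rho_mem⟩ β)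

/-- The component of the `z₂`-plane, an irreducible subrepresentation of dimension two, is not
one-dimensional. -/
theorem not_hasOneDimIsotypicComponents_Gam : ¬ HasOneDimIsotypicComponents Gam := by
  intro h
  set W := Subrepresentation.asSubmodule z2Subrep with hW
  have h1 := h (isotypicComponent (MonoidAlgebra ℝ Gam) (naturalRep Gam).asModule W)
    ⟨W, isSimpleModule_z2Subrep, rfl⟩
  have hle := Submodule.le_isotypicComponent W
  have h2 : (basisVec 2 : E4) ∈ W := mem_z2Plane.2 ⟨by simp, by simp⟩
  have h3 : (basisVec 3 : E4) ∈ W := mem_z2Plane.2 ⟨by simp, by simp⟩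
  obtain ⟨c, hc⟩ := (finrank_eq_one_iff_of_nonzero' (V := (isotypicComponent (MonoidAlgebra ℝ Gam)
      (naturalRep Gam).asModule W).restrictScalars ℝ) ⟨_, hle h2⟩ (fun h0 ↦ by
      have h4 : (basisVec 2 : E4) = 0 := congrArg Subtype.val h0
      simpa using congrArg (fun v : E4 ↦ v 2) h4)).1 h1 ⟨_, hle h3⟩
  have h4 : c • (basisVec 2 : E4) = basisVec 3 := congrArg Subtype.val hc
  simpa using congrArg (fun v : E4 ↦ v 3) h4

/-! ### Equivariant linear maps -/

lemma eq_sum_basisVec (v : E4) :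
    v = v 0 • basisVec 0 + v 1 • basisVec 1 + v 2 • basisVec 2 + v 3 • basisVec 3 := by
  ext k
  fin_cases k <;> simp

/-- A linear map that commutes with `ρ` and `κ` is diagonal, and scalar on the `z₂`-plane. -/
lemma apply_eq_of_commute {T : E4 →L[ℝ] E4} (hρ : ∀ v, T (rho v) = rho (T v))
    (hκ : ∀ v, T (kappa v) = kappa (T v)) (v : E4) (k : Fin 4) :
    T v k = ![T (basisVec 0) 0, T (basisVec 1) 1, T (basisVec 2) 2, T (basisVec 2) 2] k * v k := by
  have hs : Real.sqrt 3 ≠ 0 := by positivity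
  have r0 : rho (basisVec 0) = basisVec 0 := rho_apply_eq_self_iff.2 ⟨by simp, by simp⟩
  have r1 : rho (basisVec 1) = basisVec 1 := rho_apply_eq_self_iff.2 ⟨by simp, by simp⟩
  have k0 : kappa (basisVec 0) = basisVec 0 := kappa_apply_eq_self_iff.2 ⟨by simp, by simp⟩
  have k2 : kappa (basisVec 2) = basisVec 2 := kappa_apply_eq_self_iff.2 ⟨by simp, by simp⟩
  have k1 : kappa (basisVec 1) = -basisVec 1 := by
    obtain ⟨h0, h1, h2, h3⟩ := kappa_apply_coord (basisVec 1)
    ext k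
    fin_cases k
    · exact h0.trans (by simp)
    · exact h1.trans (by simp)
    · exact h2.trans (by simp)
    · exact h3.trans (by simp)
  have r2 : rho (basisVec 2) = (-1 / 2 : ℝ) • basisVec 2 + (Real.sqrt 3 / 2) • basisVec 3 := by
    obtain ⟨h0, h1, h2, h3⟩ := rho_apply_coord (basisVec 2)
    ext k
    fin_cases k
    · exact h0.trans (by simp)
    · exact h1.trans (by simp)
    · exact h2.trans (by simp)
    · exact h3.trans (by simp)
  -- Images of fixed vectors are fixed.
  have a0 := hρ (basisVec 0)
  have b0 := hκ (basisVec 0)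
  rw [r0, eq_comm, rho_apply_eq_self_iff] at a0
  rw [k0, eq_comm, kappa_apply_eq_self_iff] at b0
  have a1 := hρ (basisVec 1)
  have b1 := congrArg (fun v : E4 ↦ v 0) (hκ (basisVec 1))
  rw [r1, eq_comm, rho_apply_eq_self_iff] at a1
  simp only [k1, map_neg, PiLp.neg_apply, (kappa_apply_coord _).1] at b1
  have b2 := hκ (basisVec 2)
  rw [k2, eq_comm, kappa_apply_eq_self_iff] at b2
  -- On the `z₂`-plane, `e 3` is a combination of `e 2` and `ρ (e 2)`.
  have a2 := hρ (basisVec 2)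
  rw [r2, map_add, map_smul, map_smul] at a2
  obtain ⟨c0, c1, c2, c3⟩ := rho_apply_coord (T (basisVec 2))
  rw [← a2] at c0 c1 c2 c3
  simp only [PiLp.add_apply, PiLp.smul_apply, smul_eq_mul] at c0 c1 c2 c3
  have hκ3 : kappa (basisVec 3) = -basisVec 3 := by
    obtain ⟨h0, h1, h2, h3⟩ := kappa_apply_coord (basisVec 3)
    ext k
    fin_cases k
    · exact h0.trans (by simp)
    · exact h1.trans (by simp)
    · exact h2.trans (by simp)
    · exact h3.trans (by simp)
  have b3 := hκ (basisVec 3)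
  rw [hκ3, map_neg] at b3
  have d0 := congrArg (fun v : E4 ↦ v 0) b3
  have d2 := congrArg (fun v : E4 ↦ v 2) b3
  simp only [PiLp.neg_apply, (kappa_apply_coord _).1, (kappa_apply_coord _).2.2.1] at d0 d2
  have e0 : T (basisVec 3) 0 = 0 := by linarith
  have e2 : T (basisVec 3) 2 = 0 := by linarith
  have f0 : T (basisVec 2) 0 = 0 := by rw [e0] at c0; linarith
  have e1 : T (basisVec 3) 1 = 0 := by
    rw [b2.1] at c1
    have : Real.sqrt 3 / 2 * T (basisVec 3) 1 = 0 := by linarith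
    exact (mul_eq_zero.1 this).resolve_left (by positivity)
  have e3 : T (basisVec 3) 3 = T (basisVec 2) 2 := by
    rw [b2.2] at c3
    have : Real.sqrt 3 / 2 * T (basisVec 3) 3 = Real.sqrt 3 / 2 * T (basisVec 2) 2 := by linarith
    exact mul_left_cancel₀ (by positivity) this
  have hv : T v = v 0 • T (basisVec 0) + v 1 • T (basisVec 1) + v 2 • T (basisVec 2) +
      v 3 • T (basisVec 3) := by
    conv_lhs => rw [eq_sum_basisVec v]
    simp only [map_add, map_smul]
  have g0 : T (basisVec 1) 0 = 0 := by linarith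
  rw [hv]
  simp only [PiLp.add_apply, PiLp.smul_apply, smul_eq_mul]
  fin_cases k <;> simp [a0, b0, a1, g0, b2, e0, e1, e2, e3, f0, mul_comm]

/-! ### Spectra of diagonal maps -/

lemma mapsTo_coordPlane_of_diagonal {T : E4 →ₗ[ℝ] E4} {d : Fin 4 → ℝ}
    (hT : ∀ v k, T v k = d k * v k) (i j : Fin 4) : ∀ v ∈ coordPlane i j, T v ∈ coordPlane i j := by
  intro v hv k hi hj
  rw [hT, hv k hi hj, mul_zero]

lemma mem_aroots_charpoly_restrict_coordPlane {T : E4 →ₗ[ℝ] E4} {d : Fin 4 → ℝ}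
    (hT : ∀ v k, T v k = d k * v k) {i j : Fin 4} (hij : i ≠ j)
    (h : ∀ v ∈ coordPlane i j, T v ∈ coordPlane i j) (z : ℂ) :
    z ∈ (LinearMap.charpoly (T.restrict h)).aroots ℂ ↔ z = d i ∨ z = d j := by
  let b := Module.Basis.ofEquivFun (coordPlaneEquiv hij)
  have hM : LinearMap.toMatrix b b (T.restrict h) = Matrix.diagonal ![d i, d j] := by
    ext k l
    rw [LinearMap.toMatrix_apply, Module.Basis.ofEquivFun_repr_apply]
    fin_cases k <;> fin_cases l <;>
      simp [b, coordPlaneEquiv, hT, hij, hij.symm]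
  rw [← LinearMap.charpoly_toMatrix _ b, hM, Matrix.charpoly_diagonal, Polynomial.mem_aroots]
  rw [and_iff_right (Finset.prod_ne_zero_iff.2 fun _ _ ↦ Polynomial.X_sub_C_ne_zero _)]
  simp [Fin.prod_univ_two, sub_eq_zero]

lemma isSinkIn_of_diagonal {f : E4 → E4} {ξ : E4} {d : Fin 4 → ℝ}
    (hd : ∀ v k, fderiv ℝ f ξ v k = d k * v k) {i j : Fin 4} (hij : i ≠ j) (hi : d i < 0)
    (hj : d j < 0) : IsSinkIn f ξ (coordPlane i j) := by
  refine ⟨mapsTo_coordPlane_of_diagonal hd i j, fun z hz ↦ ?_⟩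
  rcases (mem_aroots_charpoly_restrict_coordPlane hd hij _ z).1 hz with rfl | rfl
  · exact hi
  · exact hj

lemma isSaddleIn_of_diagonal {f : E4 → E4} {ξ : E4} {d : Fin 4 → ℝ}
    (hd : ∀ v k, fderiv ℝ f ξ v k = d k * v k) {i j : Fin 4} (hij : i ≠ j) (hi : d i < 0)
    (hj : 0 < d j) : IsSaddleIn f ξ (coordPlane i j) := by
  have hmem := mem_aroots_charpoly_restrict_coordPlane (T := (fderiv ℝ f ξ : E4 →ₗ[ℝ] E4)) hd hij
    (mapsTo_coordPlane_of_diagonal hd i j)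
  refine ⟨mapsTo_coordPlane_of_diagonal hd i j, fun z hz ↦ ?_, ⟨d i, (hmem _).2 (.inl rfl), hi⟩,
    ⟨d j, (hmem _).2 (.inr rfl), hj⟩⟩
  rcases (hmem z).1 hz with rfl | rfl
  · exact hi.ne
  · exact hj.ne'

lemma isDoubleEigenvalueOnZ2_of_diagonal {f : E4 → E4} {ξ : E4} {d : Fin 4 → ℝ}
    (hd : ∀ v k, fderiv ℝ f ξ v k = d k * v k) (h23 : d 3 = d 2) (h0 : d 0 ≠ d 2)
    (h1 : d 1 ≠ d 2) : IsDoubleEigenvalueOnZ2 f ξ (d 2) := by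
  set T := (fderiv ℝ f ξ : E4 →ₗ[ℝ] E4) with hT
  have hd' : ∀ v k, T v k = d k * v k := hd
  have hpow : ∀ (n : ℕ) (v : E4) (k : Fin 4),
      ((T - algebraMap ℝ (Module.End ℝ E4) (d 2)) ^ n) v k = (d k - d 2) ^ n * v k := by
    intro n v k
    induction n with
    | zero => simp
    | succ n ih =>
      rw [pow_succ', Module.End.mul_apply, LinearMap.sub_apply, PiLp.sub_apply, hd',
        Module.algebraMap_end_apply, PiLp.smul_apply, ih, smul_eq_mul]
      ring
  have hle : z2Plane ≤ Module.End.eigenspace T (d 2) := by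
    intro v hv
    rw [Module.End.mem_eigenspace_iff]
    ext k
    rw [hd', PiLp.smul_apply, smul_eq_mul]
    fin_cases k <;> simp [hv.1, hv.2, h23]
  have hge : Module.End.maxGenEigenspace T (d 2) ≤ z2Plane := by
    intro v hv
    obtain ⟨n, hn⟩ := (Module.End.mem_maxGenEigenspace _ _ _).1 hv
    have hk : ∀ k, d k ≠ d 2 → v k = 0 := by
      intro k hk
      have h2 := hpow n v k
      rw [Algebra.algebraMap_eq_smul_one, hn] at h2
      exact (mul_eq_zero.1 h2.symm).resolve_left (pow_ne_zero _ (sub_ne_zero.2 hk))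
    exact ⟨hk 0 h0, hk 1 h1⟩
  have hmid : Module.End.eigenspace T (d 2) ≤ Module.End.maxGenEigenspace T (d 2) := by
    rw [Module.End.eigenspace_def, ← Module.End.genEigenspace_one]
    exact Module.End.genEigenspace_le_maximal _ _ _
  exact ⟨le_antisymm (hmid.trans hge) hle, le_antisymm hge (hle.trans hmid)⟩

/-! ### The model vector field -/

/-- In complex coordinates, with `z₁ = x₁ + i y₁` and `|z|² = |z₁|² + |z₂|²`, the vector field
`(z₁ (1 - |z|²) + y₁² - |z₂|² - i x₁ y₁, z₂ (1 - |z|²) + x₁ z₂)`. The unit circles of `Fix ρ` and of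
`Fix κ` are invariant and attracting within these planes; the flow runs along the first from
`(-1, 0)` to `(1, 0)` and along the second from `(1, 0)` to `(-1, 0)`. -/
noncomputable def modelMap (v : E4) : E4 :=
  let S := v 0 ^ 2 + v 1 ^ 2 + v 2 ^ 2 + v 3 ^ 2
  !₂[v 0 * (1 - S) + v 1 ^ 2 - v 2 ^ 2 - v 3 ^ 2, v 1 * (1 - S) - v 0 * v 1,
    v 2 * (1 - S) + v 0 * v 2, v 3 * (1 - S) + v 0 * v 3]

lemma modelMap_coord (v : E4) :
    modelMap v 0 = v 0 * (1 - (v 0 ^ 2 + v 1 ^ 2 + v 2 ^ 2 + v 3 ^ 2)) +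
        v 1 ^ 2 - v 2 ^ 2 - v 3 ^ 2 ∧
      modelMap v 1 = v 1 * (1 - (v 0 ^ 2 + v 1 ^ 2 + v 2 ^ 2 + v 3 ^ 2)) - v 0 * v 1 ∧
      modelMap v 2 = v 2 * (1 - (v 0 ^ 2 + v 1 ^ 2 + v 2 ^ 2 + v 3 ^ 2)) + v 0 * v 2 ∧
      modelMap v 3 = v 3 * (1 - (v 0 ^ 2 + v 1 ^ 2 + v 2 ^ 2 + v 3 ^ 2)) + v 0 * v 3 :=
  ⟨rfl, rfl, rfl, rfl⟩

lemma contDiff_modelMap : ContDiff ℝ ∞ modelMap := by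
  rw [contDiff_piLp]
  intro i
  fin_cases i <;> simp [modelMap] <;> fun_prop

lemma modelMap_rho (v : E4) : modelMap (rho v) = rho (modelMap v) := by
  obtain ⟨h0, h1, h2, h3⟩ := rho_apply_coord v
  obtain ⟨m0, m1, m2, m3⟩ := modelMap_coord v
  obtain ⟨n0, n1, n2, n3⟩ := modelMap_coord (rho v)
  obtain ⟨k0, k1, k2, k3⟩ := rho_apply_coord (modelMap v)
  have hs : Real.sqrt 3 ^ 2 = 3 := Real.sq_sqrt (by norm_num)
  have hsq : rho v 2 ^ 2 + rho v 3 ^ 2 = v 2 ^ 2 + v 3 ^ 2 := by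
    rw [h2, h3]
    linear_combination (v 2 ^ 2 + v 3 ^ 2) / 4 * hs
  have hS : rho v 0 ^ 2 + rho v 1 ^ 2 + rho v 2 ^ 2 + rho v 3 ^ 2 =
      v 0 ^ 2 + v 1 ^ 2 + v 2 ^ 2 + v 3 ^ 2 := by
    rw [add_assoc, hsq, h0, h1]
    ring
  rw [hS] at n0 n1 n2 n3
  have e0 : modelMap (rho v) 0 = rho (modelMap v) 0 := by
    rw [n0, k0, m0, h0, h1]
    linear_combination -hsq
  have e1 : modelMap (rho v) 1 = rho (modelMap v) 1 := by rw [n1, k1, m1, h0, h1]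
  have e2 : modelMap (rho v) 2 = rho (modelMap v) 2 := by
    rw [n2, k2, m2, m3, h0, h2]
    ring
  have e3 : modelMap (rho v) 3 = rho (modelMap v) 3 := by
    rw [n3, k3, m2, m3, h0, h3]
    ring
  ext k
  fin_cases k
  · exact e0
  · exact e1
  · exact e2
  · exact e3

lemma modelMap_kappa (v : E4) : modelMap (kappa v) = kappa (modelMap v) := by
  obtain ⟨h0, h1, h2, h3⟩ := kappa_apply_coord v
  obtain ⟨m0, m1, m2, m3⟩ := modelMap_coord v
  obtain ⟨n0, n1, n2, n3⟩ := modelMap_coord (kappa v)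
  obtain ⟨k0, k1, k2, k3⟩ := kappa_apply_coord (modelMap v)
  ext k
  fin_cases k
  · refine n0.trans (Eq.trans ?_ k0.symm)
    rw [m0, h0, h1, h2, h3]
    ring
  · refine n1.trans (Eq.trans ?_ k1.symm)
    rw [m1, h0, h1, h2, h3]
    ring
  · refine n2.trans (Eq.trans ?_ k2.symm)
    rw [m2, h0, h1, h2, h3]
    ring
  · refine n3.trans (Eq.trans ?_ k3.symm)
    rw [m3, h0, h1, h2, h3]
    ring

lemma equivariant_of_generators {f : E4 → E4} (hρ : ∀ x, f (rho x) = rho (f x))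
    (hκ : ∀ x, f (kappa x) = kappa (f x)) {γ : O4} (hγ : γ ∈ Gam) : ∀ x, f (γ x) = γ (f x) := by
  induction hγ using Subgroup.closure_induction with
  | mem g hg =>
    rcases hg with rfl | rfl
    · exact hρ
    · exact hκ
  | one => exact fun _ ↦ rfl
  | mul g h _ _ hg hh =>
    intro x
    rw [LinearIsometryEquiv.coe_mul, Function.comp_apply, Function.comp_apply, hg, hh]
  | inv g _ hg =>
    intro x
    have h1 := hg (g⁻¹ x)
    have h2 : g (g⁻¹ x) = x := g.apply_symm_apply x
    rw [h2] at h1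
    rw [h1]
    exact (g.symm_apply_apply _).symm

/-- The model map as an element of the space of smooth equivariant vector fields. -/
noncomputable def modelField : EquivariantField Gam :=
  ⟨modelMap, contDiff_modelMap, fun _ hγ ↦ equivariant_of_generators modelMap_rho modelMap_kappa hγ⟩

/-! ### A neighbourhood of the model vector field -/

/-- The equivariant vector fields that are close to the model field on the ball of radius `2`,
together with their derivatives. The bound `1 / 20` is small enough to preserve the conditions of a
turning field on both planes and the order of the eigenvalues at the equilibria. -/
def modelNhd : Set (EquivariantField Gam) :=
  {f | ∀ x ∈ Metric.closedBall (0 : E4) 2,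
    ‖f x - modelMap x‖ < 1 / 20 ∧ ‖fderiv ℝ f x - fderiv ℝ modelMap x‖ < 1 / 20}

lemma isOpen_setOf_norm_sub_lt {X V : Type*} [TopologicalSpace X] [NormedAddCommGroup V]
    {K : Set X} (hK : IsCompact K) (g₀ : C(X, V)) (ε : ℝ) :
    IsOpen {g : C(X, V) | ∀ x ∈ K, ‖g x - g₀ x‖ < ε} := by
  have hcont : Continuous fun g : C(X, V) ↦
      (⟨norm, continuous_norm⟩ : C(V, ℝ)).comp (g - g₀) :=
    (ContinuousMap.continuous_postcomp _).comp (continuous_id.sub continuous_const)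
  exact (ContinuousMap.isOpen_setOfPred_mapsTo hK (isOpen_Iio (a := ε))).preimage hcont

lemma isOpen_modelNhd : IsOpen modelNhd := by
  have hK : IsCompact (Metric.closedBall (0 : E4) 2) := isCompact_closedBall _ _
  have heq : modelNhd = EquivariantField.oneJet ⁻¹'
      ({g | ∀ x ∈ Metric.closedBall (0 : E4) 2, ‖g x - modelField.oneJet.1 x‖ < 1 / 20} ×ˢ
        {g | ∀ x ∈ Metric.closedBall (0 : E4) 2, ‖g x - modelField.oneJet.2 x‖ < 1 / 20}) :=
    Set.ext fun f ↦ forall₂_and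
  rw [heq]
  exact ((isOpen_setOf_norm_sub_lt hK modelField.oneJet.1 (1 / 20)).prod
    (isOpen_setOf_norm_sub_lt hK modelField.oneJet.2 (1 / 20))).preimage continuous_induced_dom

lemma modelField_mem : modelField ∈ modelNhd := by
  intro x _
  change ‖modelMap x - modelMap x‖ < _ ∧ ‖fderiv ℝ modelMap x - fderiv ℝ modelMap x‖ < _
  rw [sub_self, sub_self, norm_zero, norm_zero]
  norm_num

lemma EquivariantField.map_mem_fixedSpace (f : EquivariantField Gam) {S : Subgroup O4}
    (hS : S ≤ Gam) {v : E4} (hv : v ∈ fixedSpace S) : f v ∈ fixedSpace S := by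
  intro γ hγ
  rw [← f.2.2 γ (hS hγ), hv γ hγ]

lemma abs_sub_modelMap_le {f : EquivariantField Gam} (hf : f ∈ modelNhd) {v : E4} (hv : ‖v‖ ≤ 2)
    (k : Fin 4) : |f v k - modelMap v k| ≤ 1 / 20 :=
  (PiLp.norm_apply_le (f v - modelMap v) k).trans
    (hf v (mem_closedBall_zero_iff.2 hv)).1.le

/-- The `C¹` bound makes the difference to the model field Lipschitz with a small constant. -/
lemma abs_sub_modelMap_sub_le {f : EquivariantField Gam} (hf : f ∈ modelNhd) {v w : E4}
    (hv : ‖v‖ ≤ 2) (hw : ‖w‖ ≤ 2) (k : Fin 4) :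
    |(f v k - modelMap v k) - (f w k - modelMap w k)| ≤ 1 / 20 * ‖v - w‖ := by
  have hdf : Differentiable ℝ f := f.2.1.differentiable (by simp)
  have hdm : Differentiable ℝ modelMap := contDiff_modelMap.differentiable (by simp)
  have h := (convex_closedBall (0 : E4) 2).norm_image_sub_le_of_norm_fderiv_le (𝕜 := ℝ)
    (f := fun x ↦ f x - modelMap x) (C := 1 / 20)
    (fun x _ ↦ (hdf x).sub (hdm x)) (fun x hx ↦ by
      rw [fderiv_fun_sub (hdf x) (hdm x)]
      exact (hf x hx).2.le) (mem_closedBall_zero_iff.2 hw) (mem_closedBall_zero_iff.2 hv)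
  exact (PiLp.norm_apply_le ((f v - modelMap v) - (f w - modelMap w)) k).trans h

/-! ### Linearization on the axis -/

lemma fderiv_modelMap_axisPoint (x : ℝ) :
    fderiv ℝ modelMap (axisPoint x) (basisVec 0) 0 = 1 - 3 * x ^ 2 ∧
      fderiv ℝ modelMap (axisPoint x) (basisVec 1) 1 = 1 - x ^ 2 - x ∧
      fderiv ℝ modelMap (axisPoint x) (basisVec 2) 2 = 1 - x ^ 2 + x := by
  have hline : ∀ k, HasDerivAt (fun t : ℝ ↦ modelMap (axisPoint x + t • basisVec k) k)
      (fderiv ℝ modelMap (axisPoint x) (basisVec k) k) 0 := by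
    intro k
    have h := ((contDiff_modelMap.differentiable (by simp)) (axisPoint x)).hasFDerivAt
    have h1 := h.hasLineDerivAt (basisVec k)
    exact (hasDerivAt_pi.1 ((PiLp.continuousLinearEquiv 2 ℝ
      (fun _ : Fin 4 ↦ ℝ)).toContinuousLinearMap.hasFDerivAt.comp_hasDerivAt (0 : ℝ) h1)) k
  refine ⟨(hline 0).unique ?_, (hline 1).unique ?_, (hline 2).unique ?_⟩
  · have h : HasDerivAt (fun t : ℝ ↦ (x + t) * (1 - (x + t) ^ 2)) (1 - 3 * x ^ 2) 0 := by
      have h1 : HasDerivAt (fun t : ℝ ↦ x + t) 1 0 := (hasDerivAt_id' 0).const_add x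
      refine (h1.fun_mul ((h1.fun_pow 2).const_sub 1)).congr_deriv ?_
      simp
      ring
    exact h.congr_of_eventuallyEq (.of_forall fun t ↦ by simp [modelMap, axisPoint])
  · have h : HasDerivAt (fun t : ℝ ↦ t * (1 - (x ^ 2 + t ^ 2)) - x * t) (1 - x ^ 2 - x) 0 := by
      have h1 : HasDerivAt (fun t : ℝ ↦ t) 1 0 := hasDerivAt_id' 0
      refine ((h1.fun_mul (((h1.fun_pow 2).const_add _).const_sub 1)).fun_sub
        (h1.const_mul x)).congr_deriv ?_
      simp
    exact h.congr_of_eventuallyEq (.of_forall fun t ↦ by simp [modelMap, axisPoint])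
  · have h : HasDerivAt (fun t : ℝ ↦ t * (1 - (x ^ 2 + t ^ 2)) + x * t) (1 - x ^ 2 + x) 0 := by
      have h1 : HasDerivAt (fun t : ℝ ↦ t) 1 0 := hasDerivAt_id' 0
      refine ((h1.fun_mul (((h1.fun_pow 2).const_add _).const_sub 1)).fun_add
        (h1.const_mul x)).congr_deriv ?_
      simp
    exact h.congr_of_eventuallyEq (.of_forall fun t ↦ by simp [modelMap, axisPoint])

lemma norm_axisPoint (x : ℝ) : ‖axisPoint x‖ = |x| := by
  rw [axisPoint, norm_smul, PiLp.norm_single, norm_one, mul_one, Real.norm_eq_abs]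

lemma fderiv_apply_of_equivariant {f : E4 → E4} (hf : Differentiable ℝ f) {γ : O4}
    (h : ∀ x, f (γ x) = γ (f x)) {ξ : E4} (hξ : γ ξ = ξ) (v : E4) :
    fderiv ℝ f ξ (γ v) = γ (fderiv ℝ f ξ v) := by
  let L : E4 →L[ℝ] E4 := (γ.toContinuousLinearEquiv : E4 →L[ℝ] E4)
  have h1 : HasFDerivAt (fun x ↦ f (γ x)) ((fderiv ℝ f ξ).comp L) ξ := by
    have h2 : HasFDerivAt f (fderiv ℝ f ξ) (L ξ) := by
      rw [show L ξ = ξ from hξ]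
      exact (hf ξ).hasFDerivAt
    exact h2.comp ξ L.hasFDerivAt
  have h3 : HasFDerivAt (fun x ↦ γ (f x)) (L.comp (fderiv ℝ f ξ)) ξ :=
    L.hasFDerivAt.comp ξ (hf ξ).hasFDerivAt
  simp_rw [h] at h1
  exact DFunLike.congr_fun (h1.unique h3) v

/-- The linearization at a point of the axis is diagonal with eigenvalues close to those of the
model field. -/
lemma exists_diagonal_fderiv {f : EquivariantField Gam} (hf : f ∈ modelNhd) {x : ℝ}
    (hx : |x| ≤ 2) :
    ∃ d : Fin 4 → ℝ, (∀ v k, fderiv ℝ f (axisPoint x) v k = d k * v k) ∧ d 3 = d 2 ∧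
      |d 0 - (1 - 3 * x ^ 2)| ≤ 1 / 20 ∧ |d 1 - (1 - x ^ 2 - x)| ≤ 1 / 20 ∧
      |d 2 - (1 - x ^ 2 + x)| ≤ 1 / 20 := by
  have hdf : Differentiable ℝ f := f.2.1.differentiable (by simp)
  have hcomm : ∀ γ ∈ Gam, ∀ v, fderiv ℝ f (axisPoint x) (γ v) = γ (fderiv ℝ f (axisPoint x) v) :=
    fun γ hγ ↦ fderiv_apply_of_equivariant hdf (f.2.2 γ hγ) (axisPoint_mem x γ hγ)
  obtain ⟨m0, m1, m2⟩ := fderiv_modelMap_axisPoint x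
  have hclose : ∀ k, |fderiv ℝ f (axisPoint x) (basisVec k) k -
      fderiv ℝ modelMap (axisPoint x) (basisVec k) k| ≤ 1 / 20 := by
    intro k
    have h1 := (hf (axisPoint x) (by rwa [mem_closedBall_zero_iff, norm_axisPoint])).2.le
    refine (PiLp.norm_apply_le ((fderiv ℝ f (axisPoint x) - fderiv ℝ modelMap (axisPoint x))
      (basisVec k)) k).trans ((ContinuousLinearMap.le_opNorm _ _).trans ?_)
    rwa [PiLp.norm_single, norm_one, mul_one]
  refine ⟨_, apply_eq_of_commute (hcomm rho rho_mem) (hcomm kappa kappa_mem), rfl, ?_, ?_, ?_⟩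
  · exact m0 ▸ hclose 0
  · exact m1 ▸ hclose 1
  · exact m2 ▸ hclose 2

/-! ### Restriction to the planes -/

/-- A planar field that leaves the axis invariant and is `C¹`-close to
`(x (1 - r²) + y², y (1 - r²) - x y)` is a turning field: for the latter, the radial component
`x u + y v` is `r² (1 - r²)` and the angular component `x v - y u` is `-r² y`. Near the axis the
angular component is small, so the error of `v` has to be bounded by a multiple of `|y|`. -/
lemma isTurningField_of_close {F : ℝ × ℝ → ℝ × ℝ} (hax : ∀ x, (F (x, 0)).2 = 0)
    (h1 : ∀ x y : ℝ, x ^ 2 + y ^ 2 ≤ 4 →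
      |(F (x, y)).1 - (x * (1 - (x ^ 2 + y ^ 2)) + y ^ 2)| ≤ 1 / 20)
    (h2 : ∀ x y : ℝ, x ^ 2 + y ^ 2 ≤ 4 →
      |(F (x, y)).2 - (y * (1 - (x ^ 2 + y ^ 2)) - x * y)| ≤ 1 / 20 * |y|)
    (h3 : ∀ x x' : ℝ, |x| ≤ 2 → |x'| ≤ 2 →
      |((F (x, 0)).1 - x * (1 - x ^ 2)) - ((F (x', 0)).1 - x' * (1 - x' ^ 2))| ≤
        1 / 20 * |x - x'|) :
    IsTurningField F := by
  have hrad : ∀ x y : ℝ, x ^ 2 + y ^ 2 ≤ 25 / 16 →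
      |x * (F (x, y)).1 + y * (F (x, y)).2 - (x ^ 2 + y ^ 2) * (1 - (x ^ 2 + y ^ 2))| ≤ 9 / 64 := by
    intro x y hr
    have hx : |x| ≤ 5 / 4 := abs_le_of_sq_le_sq (by nlinarith [sq_nonneg y]) (by norm_num)
    have hp := h1 x y (by linarith)
    have hq := h2 x y (by linarith)
    set p := (F (x, y)).1 - (x * (1 - (x ^ 2 + y ^ 2)) + y ^ 2)
    set q := (F (x, y)).2 - (y * (1 - (x ^ 2 + y ^ 2)) - x * y)
    have e : x * (F (x, y)).1 + y * (F (x, y)).2 - (x ^ 2 + y ^ 2) * (1 - (x ^ 2 + y ^ 2)) =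
        x * p + y * q := by
      simp only [p, q]
      ring
    have hxp : |x * p| ≤ 5 / 4 * (1 / 20) := by
      rw [abs_mul]
      exact mul_le_mul hx hp (abs_nonneg _) (by norm_num)
    have hyq : |y * q| ≤ 1 / 20 * (25 / 16) := by
      rw [abs_mul]
      nlinarith [mul_le_mul_of_nonneg_left hq (abs_nonneg y), sq_abs y, sq_nonneg x]
    rw [e]
    exact (abs_add_le _ _).trans (by linarith)
  refine ⟨hax, fun ⟨x, y⟩ hr ↦ ?_, fun ⟨x, y⟩ hr ↦ ?_, ⟨1 / 4, by norm_num, ?_⟩, 1 / 4,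
    by norm_num, ?_⟩
  · have h := abs_le.1 (hrad x y (by simp only at hr; linarith))
    simp only at hr ⊢
    rw [hr] at h
    linarith [h.1]
  · have h := abs_le.1 (hrad x y hr.le)
    simp only at hr ⊢
    rw [hr] at h
    linarith [h.2]
  · rintro ⟨x, y⟩ hy hr hr'
    simp only at hy hr hr' ⊢
    have hx : |x| ≤ 5 / 4 := abs_le_of_sq_le_sq (by nlinarith [sq_nonneg y]) (by norm_num)
    have hp := h1 x y (by linarith)
    have hq := h2 x y (by linarith)
    set p := (F (x, y)).1 - (x * (1 - (x ^ 2 + y ^ 2)) + y ^ 2)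
    set q := (F (x, y)).2 - (y * (1 - (x ^ 2 + y ^ 2)) - x * y)
    have e : x * (F (x, y)).2 - y * (F (x, y)).1 = -(x ^ 2 + y ^ 2) * y + x * q - y * p := by
      simp only [p, q]
      ring
    have hxq : x * q ≤ 5 / 4 * (1 / 20 * y) := by
      rw [abs_of_nonneg hy] at hq
      refine (le_abs_self _).trans ?_
      rw [abs_mul]
      exact mul_le_mul hx hq (abs_nonneg _) (by norm_num)
    have hyp : -(y * p) ≤ y * (1 / 20) := by
      nlinarith [(abs_le.1 hp).1]
    rw [e]
    nlinarith [mul_le_mul_of_nonneg_right hr hy]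
  · intro x x' hxx
    have hmul : (7 / 10) ^ 2 * 3 ≤ x ^ 2 + x * x' + x' ^ 2 := by
      rcases hxx with ⟨⟨a, b⟩, c, d⟩ | ⟨⟨a, b⟩, c, d⟩ <;> nlinarith
    have hx2 : |x| ≤ 2 ∧ |x'| ≤ 2 := by
      rw [abs_le, abs_le]
      rcases hxx with ⟨⟨h1, h2⟩, h3, h4⟩ | ⟨⟨h1, h2⟩, h3, h4⟩ <;>
        exact ⟨⟨by linarith, by linarith⟩, by linarith, by linarith⟩
    have h := h3 x x' hx2.1 hx2.2
    set p := ((F (x, 0)).1 - x * (1 - x ^ 2)) - ((F (x', 0)).1 - x' * (1 - x' ^ 2))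
    have e : (x - x') * ((F (x, 0)).1 - (F (x', 0)).1) =
        (x - x') ^ 2 * (1 - (x ^ 2 + x * x' + x' ^ 2)) + (x - x') * p := by
      simp only [p]
      ring
    have hp : (x - x') * p ≤ 1 / 20 * (x - x') ^ 2 := by
      refine (le_abs_self _).trans ?_
      rw [abs_mul, ← sq_abs (x - x')]
      nlinarith [abs_nonneg (x - x')]
    rw [e]
    nlinarith [sq_nonneg (x - x')]

/-- The embedding `(x, y) ↦ σ x e₀ + y eⱼ` of the plane as a coordinate plane. -/
noncomputable def planeEmb (σ : ℝ) (j : Fin 4) : ℝ × ℝ →L[ℝ] E4 :=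
  (ContinuousLinearMap.fst ℝ ℝ ℝ).smulRight (σ • basisVec 0) +
    (ContinuousLinearMap.snd ℝ ℝ ℝ).smulRight (basisVec j)

lemma planeEmb_apply (σ : ℝ) (j : Fin 4) (p : ℝ × ℝ) :
    planeEmb σ j p = p.1 • σ • basisVec 0 + p.2 • basisVec j := rfl

lemma planeEmb_axis (σ : ℝ) (j : Fin 4) (x : ℝ) : planeEmb σ j (x, 0) = axisPoint (σ * x) := by
  rw [planeEmb_apply, zero_smul, add_zero, smul_smul, mul_comm, axisPoint]

lemma planeEmb_mem (σ : ℝ) (j : Fin 4) (p : ℝ × ℝ) : planeEmb σ j p ∈ coordPlane 0 j := by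
  intro k h0 hj
  simp [planeEmb_apply, h0, hj]

lemma planeEmb_apply_snd (σ : ℝ) {j : Fin 4} (hj : j ≠ 0) (p : ℝ × ℝ) :
    planeEmb σ j p j = p.2 := by
  simp [planeEmb_apply, hj]

/-- The vector field `f` on the plane spanned by `e 0` and `e j`, in the coordinates given by
`planeEmb σ j` with `σ = ±1`. -/
noncomputable def planeField (f : E4 → E4) (σ : ℝ) (j : Fin 4) (p : ℝ × ℝ) : ℝ × ℝ :=
  (σ * f (planeEmb σ j p) 0, f (planeEmb σ j p) j)

lemma contDiff_planeField {f : E4 → E4} (hf : ContDiff ℝ ∞ f) (σ : ℝ) (j : Fin 4) :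
    ContDiff ℝ ∞ (planeField f σ j) := by
  have h := (contDiff_piLp 2).1 (hf.comp (planeEmb σ j).contDiff)
  exact (contDiff_const.mul (h 0)).prodMk (h j)

lemma planeEmb_planeField {f : E4 → E4} {σ : ℝ} (hσ : σ * σ = 1) {j : Fin 4} (hj : j ≠ 0)
    {p : ℝ × ℝ} (h : f (planeEmb σ j p) ∈ coordPlane 0 j) :
    planeEmb σ j (planeField f σ j p) = f (planeEmb σ j p) := by
  ext k
  rw [planeEmb_apply, planeField]
  by_cases h0 : k = 0
  · subst h0
    simp only [PiLp.add_apply, PiLp.smul_apply, PiLp.single_apply, smul_eq_mul, if_true]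
    rw [if_neg hj.symm]
    linear_combination f (planeEmb σ j p) 0 * hσ
  · by_cases h1 : k = j
    · subst h1
      simp [h0]
    · rw [h k h0 h1]
      simp [h0, h1]

lemma norm_planeEmb_sq {σ : ℝ} (hσ : σ * σ = 1) {j : Fin 4} (hj : j ≠ 0) (p : ℝ × ℝ) :
    ‖planeEmb σ j p‖ ^ 2 = p.1 ^ 2 + p.2 ^ 2 := by
  rw [EuclideanSpace.norm_sq_eq, Fin.sum_univ_four]
  have h1 : p.1 ^ 2 * σ ^ 2 = p.1 ^ 2 := by rw [sq σ, hσ, mul_one]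
  fin_cases j
  · exact absurd rfl hj
  all_goals simp [planeEmb_apply, mul_pow, h1]

lemma norm_planeEmb_le_two {σ : ℝ} (hσ : σ * σ = 1) {j : Fin 4} (hj : j ≠ 0) {x y : ℝ}
    (h : x ^ 2 + y ^ 2 ≤ 4) : ‖planeEmb σ j (x, y)‖ ≤ 2 := by
  refine le_of_sq_le_sq ?_ (by norm_num)
  rw [norm_planeEmb_sq hσ hj]
  linarith

/-- On both planes the model field takes the same form, up to the reflection `x ↦ -x`. -/
lemma planeField_modelMap {σ : ℝ} {j : Fin 4} (h : σ = 1 ∧ j = 1 ∨ σ = -1 ∧ j = 2) (x y : ℝ) :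
    planeField modelMap σ j (x, y) =
      (x * (1 - (x ^ 2 + y ^ 2)) + y ^ 2, y * (1 - (x ^ 2 + y ^ 2)) - x * y) := by
  rcases h with ⟨rfl, rfl⟩ | ⟨rfl, rfl⟩
  · simp [planeField, planeEmb_apply, modelMap]
  · simp [planeField, planeEmb_apply, modelMap]
    constructor <;> ring

theorem isTurningField_planeField {f : EquivariantField Gam} (hf : f ∈ modelNhd) {σ : ℝ}
    {j : Fin 4} (h : σ = 1 ∧ j = 1 ∨ σ = -1 ∧ j = 2) : IsTurningField (planeField f σ j) := by
  have hσ : σ * σ = 1 := by rcases h with ⟨rfl, -⟩ | ⟨rfl, -⟩ <;> norm_num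
  have hσ' : |σ| = 1 := by rcases h with ⟨rfl, -⟩ | ⟨rfl, -⟩ <;> norm_num
  have hj : j ≠ 0 := by rcases h with ⟨-, rfl⟩ | ⟨-, rfl⟩ <;> decide
  have hmod := planeField_modelMap h
  have hmod1 : ∀ x y : ℝ, σ * modelMap (planeEmb σ j (x, y)) 0 =
      x * (1 - (x ^ 2 + y ^ 2)) + y ^ 2 := fun x y ↦ congrArg Prod.fst (hmod x y)
  have hmod2 : ∀ x y : ℝ, modelMap (planeEmb σ j (x, y)) j =
      y * (1 - (x ^ 2 + y ^ 2)) - x * y := fun x y ↦ congrArg Prod.snd (hmod x y)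
  have hax : ∀ x, (planeField f σ j (x, 0)).2 = 0 := by
    intro x
    have h1 := mem_fixedSpace_Gam.1 (f.map_mem_fixedSpace le_rfl (axisPoint_mem (σ * x)))
    rw [planeField, planeEmb_axis]
    rcases h with ⟨-, rfl⟩ | ⟨-, rfl⟩
    · exact h1.1
    · exact h1.2.1
  have hsq : ∀ {x : ℝ}, |x| ≤ 2 → x ^ 2 + (0 : ℝ) ^ 2 ≤ 4 := by
    intro x hx
    nlinarith [sq_abs x, abs_nonneg x]
  refine isTurningField_of_close hax (fun x y hxy ↦ ?_) (fun x y hxy ↦ ?_) fun x x' hx hx' ↦ ?_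
  · rw [← hmod1 x y]
    simp only [planeField]
    rw [← mul_sub, abs_mul, hσ', one_mul]
    exact abs_sub_modelMap_le hf (norm_planeEmb_le_two hσ hj hxy) 0
  · rw [← hmod2 x y]
    have h1 := abs_sub_modelMap_sub_le hf (norm_planeEmb_le_two hσ hj hxy)
      (norm_planeEmb_le_two hσ hj (x := x) (y := 0) (by nlinarith [sq_nonneg y])) j
    have h2 : f (planeEmb σ j (x, 0)) j = 0 := hax x
    have h3 : modelMap (planeEmb σ j (x, 0)) j = 0 := by
      rw [hmod2]
      ring
    have h4 : ‖planeEmb σ j (x, y) - planeEmb σ j (x, 0)‖ = |y| := by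
      rw [← map_sub, ← abs_norm, ← sq_eq_sq_iff_abs_eq_abs, norm_planeEmb_sq hσ hj]
      simp
    rw [h2, h3, h4, sub_zero, sub_zero] at h1
    exact h1
  · have h1 := abs_sub_modelMap_sub_le hf (norm_planeEmb_le_two hσ hj (hsq hx))
      (norm_planeEmb_le_two hσ hj (hsq hx')) 0
    have h4 : ‖planeEmb σ j (x, 0) - planeEmb σ j (x', 0)‖ = |x - x'| := by
      rw [← map_sub, ← abs_norm, ← sq_eq_sq_iff_abs_eq_abs, norm_planeEmb_sq hσ hj]
      simp
    have h5 : ∀ x : ℝ, x * (1 - x ^ 2) = σ * modelMap (planeEmb σ j (x, 0)) 0 := by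
      intro x
      rw [hmod1]
      ring
    rw [h5, h5, ← h4]
    simp only [planeField]
    rw [← mul_sub, ← mul_sub, ← mul_sub, abs_mul, hσ', one_mul]
    exact h1

/-! ### The heteroclinic cycle -/

/-- An orbit of the planar field is an orbit of `f` in the invariant coordinate plane. -/
lemma isConnection_planeEmb {f : E4 → E4} {σ : ℝ} (hσ : σ * σ = 1) {j : Fin 4} (hj : j ≠ 0)
    (hinv : ∀ v ∈ coordPlane 0 j, f v ∈ coordPlane 0 j) {γ : ℝ → ℝ × ℝ}
    (hγ : ∀ t, HasDerivAt γ (planeField f σ j (γ t)) t) (hpos : ∀ t, 0 < (γ t).2) {a b : ℝ}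
    (ha : Tendsto γ atBot (𝓝 (a, 0))) (hb : Tendsto γ atTop (𝓝 (b, 0))) :
    IsConnection f (coordPlane 0 j) (axisPoint (σ * a)) (axisPoint (σ * b))
      (fun t ↦ planeEmb σ j (γ t)) where
  solution t := by
    have h := (planeEmb σ j).hasFDerivAt.comp_hasDerivAt t (hγ t)
    rwa [planeEmb_planeField hσ hj (hinv _ (planeEmb_mem σ j _))] at h
  mem_plane t := planeEmb_mem σ j _
  nonconstant := by
    refine ⟨0, fun h ↦ (hpos 0).ne' ?_⟩
    rw [← planeEmb_apply_snd σ hj (γ 0), h, axisPoint, PiLp.smul_apply,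
      PiLp.single_apply, if_neg hj, smul_zero]
  tendsto_atBot := by
    rw [← planeEmb_axis σ j]
    exact ((planeEmb σ j).continuous.tendsto _).comp ha
  tendsto_atTop := by
    rw [← planeEmb_axis σ j]
    exact ((planeEmb σ j).continuous.tendsto _).comp hb

/-- The coordinate `x₁` does not change sign on a connected subset of the punctured axis. -/
lemma false_of_sign_change_of_mem_connectedComponentIn {x p q : E4}
    (hp : p ∈ connectedComponentIn ((fixedSpace Gam : Set E4) \ {0}) x)
    (hq : q ∈ connectedComponentIn ((fixedSpace Gam : Set E4) \ {0}) x)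
    (hp0 : p 0 < 0) (hq0 : 0 < q 0) : False := by
  have hcont : Continuous fun v : E4 ↦ v 0 := by fun_prop
  obtain ⟨v, hv, hv0⟩ := isPreconnected_connectedComponentIn.intermediate_value hp hq
    hcont.continuousOn (show (0 : ℝ) ∈ Set.Icc (p 0) (q 0) from ⟨hp0.le, hq0.le⟩)
  obtain ⟨hvL, hvne⟩ := connectedComponentIn_subset _ _ hv
  obtain ⟨h1, h2, h3⟩ := mem_fixedSpace_Gam.1 hvL
  refine hvne ?_
  ext k
  fin_cases k
  · exact hv0
  · exact h1
  · exact h2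
  · exact h3

/-- The equilibria are the zeros `a < 0 < b` of the restriction of `f` to the `x₁`-axis near `-1`
and `1`. In the coordinates of the second plane `x₁` is reflected, so that there the orbit
from `-b` to `-a` is the connection back from `b` to `a`. -/
theorem exists_cycle_of_mem_modelNhd {f : EquivariantField Gam} (hf : f ∈ modelNhd) :
    ∃ (ξ : Fin 2 → E4) (κ : Fin 2 → ℝ → E4),
      IsPseudoSimpleCycle Gam f ξ ![Subgroup.zpowers rho, Subgroup.zpowers kappa] κ ∧
      (∃ l : ℝ, l < 0 ∧ IsDoubleEigenvalueOnZ2 f (ξ 0) l) ∧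
      (∃ l : ℝ, 0 < l ∧ IsDoubleEigenvalueOnZ2 f (ξ 1) l) := by
  have hiso : ∀ {a b : ℝ} (j : Fin 2), isotropy Gam (![axisPoint a, axisPoint b] j) = Gam :=
    fun {a b} ↦ Fin.forall_fin_two.2 ⟨isotropy_axisPoint a, isotropy_axisPoint b⟩
  have hρle : Subgroup.zpowers rho ≤ Gam := (Subgroup.zpowers_le).2 rho_mem
  have hκle : Subgroup.zpowers kappa ≤ Gam := (Subgroup.zpowers_le).2 kappa_mem
  have hsmooth : ContDiff ℝ ∞ f := f.2.1
  have hF : IsTurningField (planeField f 1 1) := isTurningField_planeField hf (.inl ⟨rfl, rfl⟩)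
  have hG : IsTurningField (planeField f (-1) 2) := isTurningField_planeField hf (.inr ⟨rfl, rfl⟩)
  obtain ⟨⟨a, ha, hFa⟩, b, hb, hFb⟩ := hF.exists_zeros (contDiff_planeField hsmooth 1 1).continuous
  have hzero : ∀ {x : ℝ}, planeField f 1 1 (x, 0) = 0 → f (axisPoint x) = 0 := by
    intro x hx
    have h0 := congrArg Prod.fst hx
    simp only [planeField, planeEmb_axis, one_mul, Prod.fst_zero] at h0
    obtain ⟨h1, h2, h3⟩ := mem_fixedSpace_Gam.1 (f.map_mem_fixedSpace le_rfl (axisPoint_mem x))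
    ext k
    fin_cases k
    · exact h0
    · exact h1
    · exact h2
    · exact h3
  have hfa := hzero hFa
  have hfb := hzero hFb
  have hGzero : ∀ {x : ℝ}, f (axisPoint x) = 0 → planeField f (-1) 2 (-x, 0) = 0 := by
    intro x hx
    simp [planeField, planeEmb_axis, hx]
  obtain ⟨γ₁, d₁, p₁, s₁, t₁⟩ := hF.exists_connection (contDiff_planeField hsmooth 1 1) ha hb
    hFa hFb
  obtain ⟨γ₂, d₂, p₂, s₂, t₂⟩ := hG.exists_connection (contDiff_planeField hsmooth (-1) 2)
    (a := -b) (b := -a) ⟨by linarith [hb.2], by linarith [hb.1]⟩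
    ⟨by linarith [ha.2], by linarith [ha.1]⟩ (hGzero hfb) (hGzero hfa)
  have c₁ := isConnection_planeEmb (f := f) (by norm_num) (by decide)
    (fun v hv ↦ by
      rw [← fixedSpace_rho] at hv ⊢
      exact f.map_mem_fixedSpace hρle hv) d₁ p₁ s₁ t₁
  have c₂ := isConnection_planeEmb (f := f) (by norm_num) (by decide)
    (fun v hv ↦ by
      rw [← fixedSpace_kappa] at hv ⊢
      exact f.map_mem_fixedSpace hκle hv) d₂ p₂ s₂ t₂
  rw [one_mul, one_mul] at c₁
  rw [neg_one_mul, neg_one_mul, neg_neg, neg_neg] at c₂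
  obtain ⟨d, hd, hd3, hd0, hd1, hd2⟩ := exists_diagonal_fderiv hf (x := a)
    (abs_le.2 ⟨by linarith [ha.1], by linarith [ha.2]⟩)
  obtain ⟨e, he, he3, he0, he1, he2⟩ := exists_diagonal_fderiv hf (x := b)
    (abs_le.2 ⟨by linarith [hb.1], by linarith [hb.2]⟩)
  rw [abs_le] at hd0 hd1 hd2 he0 he1 he2
  obtain ⟨ha1, ha2⟩ := ha
  obtain ⟨hb1, hb2⟩ := hb
  -- Chord and tangent bounds for `x ^ 2`, which reduce the signs below to linear arithmetic.
  have qa1 : 0 < (a + 5 / 4) * (-3 / 4 - a) := mul_pos (by linarith) (by linarith)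
  have qa2 := sq_nonneg (a + 3 / 4)
  have qb1 : 0 < (b - 3 / 4) * (5 / 4 - b) := mul_pos (by linarith) (by linarith)
  have qb2 := sq_nonneg (b - 3 / 4)
  ring_nf at qa1 qa2 qb1 qb2
  have nd0 : d 0 < 0 := by linarith
  have nd1 : 0 < d 1 := by linarith
  have nd2 : d 2 < 0 := by linarith
  have nd02 : d 0 < d 2 := by linarith
  have ne0 : e 0 < 0 := by linarith
  have ne1 : e 1 < 0 := by linarith
  have ne2 : 0 < e 2 := by linarith
  refine ⟨![axisPoint a, axisPoint b],
    ![fun t ↦ planeEmb 1 1 (γ₁ t), fun t ↦ planeEmb (-1) 2 (γ₂ t)], ?_,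
    ⟨d 2, nd2, isDoubleEigenvalueOnZ2_of_diagonal hd hd3 nd02.ne (nd2.trans nd1).ne'⟩,
    ⟨e 2, ne2, isDoubleEigenvalueOnZ2_of_diagonal he he3 (ne0.trans ne2).ne (ne1.trans ne2).ne⟩⟩
  refine { equilibrium := ?_, dim_axis := ?_, isotropy_plane := ?_, plane_le := ?_,
           dim_plane := ?_, axis_eq := ?_, saddle := ?_, sink := ?_, connection := ?_,
           component_meets_once := ?_, not_simple := ?_ }
  · exact Fin.forall_fin_two.2 ⟨hfa, hfb⟩
  · intro j
    rw [hiso j]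
    exact finrank_fixedSpace_Gam
  · exact Fin.forall_fin_two.2 ⟨isIsotropySubgroup_rho, isIsotropySubgroup_kappa⟩
  · intro j
    rw [hiso j]
    revert j
    exact Fin.forall_fin_two.2 ⟨hρle, hκle⟩
  · refine Fin.forall_fin_two.2 ⟨?_, ?_⟩
    · change Module.finrank ℝ (fixedSpace (Subgroup.zpowers rho)) = 2
      rw [fixedSpace_rho]
      exact finrank_coordPlane (by decide)
    · change Module.finrank ℝ (fixedSpace (Subgroup.zpowers kappa)) = 2
      rw [fixedSpace_kappa]
      exact finrank_coordPlane (by decide)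
  · refine Fin.forall_fin_two.2 ⟨?_, ?_⟩
    · change fixedSpace (isotropy Gam (axisPoint b)) = _
      rw [isotropy_axisPoint]
      exact fixedSpace_Gam_eq_inf
    · change fixedSpace (isotropy Gam (axisPoint a)) = _
      rw [isotropy_axisPoint, fixedSpace_Gam_eq_inf, inf_comm]
      rfl
  · refine Fin.forall_fin_two.2 ⟨?_, ?_⟩
    · change IsSaddleIn f (axisPoint a) (fixedSpace (Subgroup.zpowers rho))
      rw [fixedSpace_rho]
      exact isSaddleIn_of_diagonal hd (by decide) nd0 nd1
    · change IsSaddleIn f (axisPoint b) (fixedSpace (Subgroup.zpowers kappa))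
      rw [fixedSpace_kappa]
      exact isSaddleIn_of_diagonal he (by decide) ne0 ne2
  · refine Fin.forall_fin_two.2 ⟨?_, ?_⟩
    · change IsSinkIn f (axisPoint b) (fixedSpace (Subgroup.zpowers rho))
      rw [fixedSpace_rho]
      exact isSinkIn_of_diagonal he (by decide) ne0 ne1
    · change IsSinkIn f (axisPoint a) (fixedSpace (Subgroup.zpowers kappa))
      rw [fixedSpace_kappa]
      exact isSinkIn_of_diagonal hd (by decide) nd0 nd2
  · refine Fin.forall_fin_two.2 ⟨?_, ?_⟩
    · change IsConnection f (fixedSpace (Subgroup.zpowers rho)) (axisPoint a) (axisPoint b) _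
      rw [fixedSpace_rho]
      exact c₁
    · change IsConnection f (fixedSpace (Subgroup.zpowers kappa)) (axisPoint b) (axisPoint a) _
      rw [fixedSpace_kappa]
      exact c₂
  · intro j x _
    rw [hiso j]
    -- The connections lie off the axis, so the cycle meets the axis in the equilibria only.
    have hcycle : ∀ p ∈ connectedComponentIn ((fixedSpace Gam : Set E4) \ {0}) x ∩
        cycleSet ![axisPoint a, axisPoint b]
          ![fun t ↦ planeEmb 1 1 (γ₁ t), fun t ↦ planeEmb (-1) 2 (γ₂ t)],
        p = axisPoint a ∨ p = axisPoint b := by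
      rintro p ⟨hpC, hp⟩
      obtain ⟨h1, h2, -⟩ := mem_fixedSpace_Gam.1 (connectedComponentIn_subset _ _ hpC).1
      rcases hp with ⟨i, rfl⟩ | hp
      · revert i
        exact Fin.forall_fin_two.2 ⟨fun _ _ _ ↦ .inl rfl, fun _ _ _ ↦ .inr rfl⟩
      · obtain ⟨i, t, rfl⟩ := Set.mem_iUnion.1 hp
        fin_cases i
        · exact absurd ((planeEmb_apply_snd 1 (by decide) (γ₁ t)).symm.trans h1) (p₁ t).ne'
        · exact absurd ((planeEmb_apply_snd (-1) (by decide) (γ₂ t)).symm.trans h2) (p₂ t).ne'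
    have hneg : axisPoint a 0 < 0 := by rw [(axisPoint_coord a).1]; linarith
    have hpos : 0 < axisPoint b 0 := by rw [(axisPoint_coord b).1]; linarith
    intro p hp q hq
    rcases hcycle p hp with rfl | rfl <;> rcases hcycle q hq with rfl | rfl
    · rfl
    · exact (false_of_sign_change_of_mem_connectedComponentIn hp.1 hq.1 hneg hpos).elim
    · exact (false_of_sign_change_of_mem_connectedComponentIn hq.1 hp.1 hneg hpos).elim
    · rfl
  · intro h
    have h0 := h 0
    rw [hiso] at h0
    exact not_hasOneDimIsotypicComponents_Gam h0

end PseudoSimple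
theorem proposition1 :
    (∀ γ ∈ PseudoSimple.Gam,
      LinearMap.det (γ.toLinearEquiv : PseudoSimple.E4 →ₗ[ℝ] PseudoSimple.E4) = 1) ∧
    Nonempty (PseudoSimple.Gam ≃* DihedralGroup 3) ∧
    PseudoSimple.AdmitsPseudoSimpleCycles PseudoSimple.Gam ∧
    ∃ U : Set (PseudoSimple.EquivariantField PseudoSimple.Gam),
      IsOpen U ∧ U.Nonempty ∧ ∀ f ∈ U,
        ∃ (ξ : Fin 2 → PseudoSimple.E4) (κ : Fin 2 → ℝ → PseudoSimple.E4),
          PseudoSimple.IsPseudoSimpleCycle PseudoSimple.Gam f ξ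
            ![Subgroup.zpowers PseudoSimple.rho, Subgroup.zpowers PseudoSimple.kappa] κ ∧
          (∃ l : ℝ, l < 0 ∧ PseudoSimple.IsDoubleEigenvalueOnZ2 f (ξ 0) l) ∧
          (∃ l : ℝ, 0 < l ∧ PseudoSimple.IsDoubleEigenvalueOnZ2 f (ξ 1) l) := by
  refine ⟨fun γ hγ ↦ PseudoSimple.det_eq_one hγ, PseudoSimple.nonempty_mulEquiv_dihedralGroup,
    ⟨PseudoSimple.modelNhd, PseudoSimple.isOpen_modelNhd, ⟨_, PseudoSimple.modelField_mem⟩,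
      fun f hf ↦ ?_⟩,
    PseudoSimple.modelNhd, PseudoSimple.isOpen_modelNhd, ⟨_, PseudoSimple.modelField_mem⟩,
    fun f hf ↦ PseudoSimple.exists_cycle_of_mem_modelNhd hf⟩
  obtain ⟨ξ, κ, h, -, -⟩ := PseudoSimple.exists_cycle_of_mem_modelNhd hf
  exact ⟨2, inferInstance, ξ, _, κ, h⟩
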